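/- Conventions. Fix $r\in\{-1,0,1,2,\dots,\infty\}$; "smooth" means $C^r$, where for $r\ge 0$ manifolds are finite-dimensional $C^r$ manifolds without boundary, and for $r=-1$ manifolds are arbitrary topological spaces and smooth maps are continuous maps (a submersion is then a continuous map with a continuous local section through every point). In a groupoid $\alpha,\beta$ are source and target, composition is written $a+b$ (defined when $\beta a=\alpha b$). A partial diffeomorphism is an injective partial map with open domain and range which is smooth with smooth inverse. A Lie groupoid $(G,X)$ is a groupoid $G$ over $X$ with smooth structures on $G$ and $X$ such that $X$ is a submanifold of $G$, $\alpha,\beta$ are smooth submersions, $G\sqcap_\beta G=\{(a,b):\beta a=\beta b\}$ is a submanifold of $G\times G$, and $(a,b)\mapsto a-b$ is smooth on it. Let $\mathcal C=(C,G,\delta)$ be a crossed module of groupoids over $X$: $C$ is a totally intransitive groupoid over $X$, $G$ acts on it by $(c,a)\mapsto c^a$, and $\delta:C\to G$ is a morphism over $X$ with $\delta(c^a)=-a+\delta c+a$ and $c^{\delta c_1}=-c_1+c+c_1$. The double groupoid $\mathcal D(\mathcal C)$ consists of the squares $w=(w_1;b,a,c,d)$ with bottom edge $a$, top edge $d$,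 left edge $b$, right edge $c$, $w_1\in C(\beta a)$ and $\delta(w_1)=-a-b+d+c$. For the vertical groupoid structure over $G$, $\alpha_1w=d$, $\beta_1w=a$ and $$(w_1;b,a,c,d)+_1(w_1';b',a',c',a)=(w_1'+w_1^{c'};\,b+b',a',c+c',d),$$ with identities $1_a$; the horizontal composition is $(w_1;b,a,c,d)+_2(v_1;c,i,j,e)=(w_1^{i}+v_1;\,b,a+i,j,d+e)$. Suppose $(G,X)$ is a Lie groupoid. A local linear (coadmissible) section $s=(s_0,s_1)$ of $\mathcal D(\mathcal C)$ consists of partial maps $s_0:X\to G$, $s_1:G\to C$ with open domains $U_0,U_1$ such that $\alpha(U_1),\beta(U_1)\subseteq U_0$; $\beta s_0(x)=x$, $\beta s_1(a)=\beta a$; writing $s(a)$ for the square with element $s_1(a)$, bottom edge $a$ and vertical edges $s_0\alpha(a)$, $s_0\beta(a)$, we have $s(a+b)=s(a)+_2s(b)$ whenever $a,b,a+b\in U_1$; and $f_0=\alpha s_0$, $f_1=\alpha_1s$ are partial diffeomorphisms with $f_1$ and $f_1^{-1}$ linear (i.e. preserving sums wherever these are defined in the respective domain). The product is $(s*t)(a)=s(\alpha_1t(a))+_1t(a)$,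 $(s*t)_0(x)=s_0(\alpha t_0(x))+t_0(x)$, and the inverse is $s^{-1}(f_1(a))=-_1s(a)$, $(s^{-1})_0(f_0(x))=-s_0(x)$. Two such sections have the same germ at $a\in G$ if they agree on a pair of open sets $(V_0,V_1)$ contained in both pairs of domains, with $a\in V_1$ and $\alpha(V_1),\beta(V_1)\subseteq V_0$. The germs form a groupoid $J(\mathcal D(\mathcal C))$ over $G$, where $[s]_a$ has source $f_1(a)$ and target $a$, and $[s]_{\alpha_1t(a)}*[t]_a=[s*t]_a$. The final map is the morphism $\psi:J(\mathcal D(\mathcal C))\to(\mathcal D(\mathcal C),+_1)$, $\psi[s]_a=s(a)$, and $\operatorname{Ker}\psi=\{[s]_a:s(a)=1_a\}$. A $V$-locally Lie double groupoid structure $(\mathcal D(\mathcal C),W^G)$ consists of smooth structures on $G,X$ making $(G,X)$ a Lie groupoid, and a smooth manifold $W$ contained as a set in $C$ with $\beta:W\to X$ a smooth surjective submersion, such that, with $W^G$ the set of squares whose element $w_1$ lies in $W$, regarded as a submanifold of $W\times G\times G\times G$ via $w\mapsto(w_1,b,a,c)$: (S1) $W^G=-_1W^G$; (S2) all identities $1_a$,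 $a\in G$, lie in $W^G$; (S3) the set of pairs $(w,v)\in W^G\times W^G$ with $\beta_1w=\beta_1v$ and $w-_1v\in W^G$ is open in $W^G\sqcap_{\beta_1}W^G$, and $(w,v)\mapsto w-_1v$ is smooth from it to $W^G$; (S4) $\alpha_1,\beta_1$ are smooth on $W^G$, and there are enough smooth sections: whenever some local linear coadmissible section passes through $w\in W^G$ (i.e. has value $w$ at $\beta_1w$), there is also one through $w$ that lies in $\Gamma^r(W^G)$, the set of local linear coadmissible sections $s$ with values in $W^G$ such that $s_0:U_0\to G$ and $s_1:U_1\to W$ are smooth; (S5) $W^G$ generates $\mathcal D(\mathcal C)$ as a groupoid with respect to $+_1$. Let $J^r(W^G)$ be the set of germs of elements of $\Gamma^r(W^G)$, let $J^r(\mathcal D(\mathcal C))$ be the subgroupoid of $J(\mathcal D(\mathcal C))$ of germs of sections obtained from $\Gamma^r(W^G)$ by products and inverses, and let $J_0=J^r(W^G)\cap\operatorname{Ker}\psi$. Statement. For every $V$-locally Lie double groupoid $(\mathcal D(\mathcal C),W^G)$, the set $J_0$ is a wide subgroupoid of $J^r(\mathcal D(\mathcal C))$ (it contains the identity germ at every $a\in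 G$), it consists of loops, and it is normal in $J^r(\mathcal D(\mathcal C))$. Consequently the quotient groupoid $\mathrm{Hol}(\mathcal D(\mathcal C),W^G)=J^r(\mathcal D(\mathcal C))/J_0$ is defined: the relation $p*q^{-1}\in J_0$ on parallel arrows $p,q$ of $J^r(\mathcal D(\mathcal C))$ is a congruence (an equivalence relation compatible with composition), and two parallel arrows become equal in the quotient if and only if they are so related. -/

import Mathlib

open CategoryTheory

universe u v w

noncomputable section

/-! ### Manifolds of class `C^r`, `r ≥ -1` -/

/-- The orders of smoothness `r ≥ -1`: `negOne` is `r = -1` (arbitrary topological spaces and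
continuous maps), `cr n` is `r = n` for `n = 0, 1, 2, …, ∞`. -/
inductive Smoothness : Type
  | negOne : Smoothness
  | cr (n : ℕ∞) : Smoothness

/-- An atlas making the topological space `M` a `C^n` manifold: finite-dimensional, without
boundary. -/
structure ManifoldAtlas (n : ℕ∞) (M : Type u) [TopologicalSpace M] : Type (max u 1) where
  E : Type
  H : Type
  [normed : NormedAddCommGroup E]
  [space : NormedSpace ℝ E]
  [finDim : FiniteDimensional ℝ E]
  [topH : TopologicalSpace H]
  I : ModelWithCorners ℝ E H
  [boundaryless : I.Boundaryless]
  [charted : ChartedSpace H M]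
  [mfd : IsManifold I n M]

attribute [instance] ManifoldAtlas.normed ManifoldAtlas.space ManifoldAtlas.finDim
  ManifoldAtlas.topH ManifoldAtlas.boundaryless

/-- The data of a `C^r` structure besides the topology: nothing for `r = -1`. -/
def AtlasData : (r : Smoothness) → (M : Type u) → [TopologicalSpace M] → Type (max u 1)
  | .negOne, _, _ => PUnit
  | .cr n, M, _ => ManifoldAtlas n M

/-- A structure of `C^r` manifold on the set `M`. -/
structure CrStructure (r : Smoothness) (M : Type u) : Type (max u 1) where
  top : TopologicalSpace M
  atlas : @AtlasData r M top

namespace CrStructure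

variable {r : Smoothness} {M : Type u} {N : Type v} {P : Type w}

def IsOpen (A : CrStructure r M) (U : Set M) : Prop := @_root_.IsOpen M A.top U

/-- `f` is of class `C^r` on the set `S`. For an open `S`, or for `S` a submanifold of `M` with its
induced structure, this says that the map `S → N` is of class `C^r`. -/
def SmoothOn : {r : Smoothness} → (A : CrStructure r M) → (B : CrStructure r N) →
    (f : M → N) → (S : Set M) → Prop
  | .negOne, A, B, f, S => @ContinuousOn M N A.top B.top f S
  | .cr n, ⟨tM, a⟩, ⟨tN, b⟩, f, S =>
    letI := tM; letI := tN
    letI a' : ManifoldAtlas n M := a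
    letI b' : ManifoldAtlas n N := b
    letI := a'.charted; letI := b'.charted
    ContMDiffOn a'.I b'.I n f S

/-- The product manifold. -/
def prod : {r : Smoothness} → (A : CrStructure r M) → (B : CrStructure r N) →
    CrStructure r (M × N)
  | .negOne, A, B => ⟨@instTopologicalSpaceProd M N A.top B.top, PUnit.unit⟩
  | .cr n, ⟨tM, a⟩, ⟨tN, b⟩ =>
    letI := tM; letI := tN
    letI a' : ManifoldAtlas n M := a
    letI b' : ManifoldAtlas n N := b
    letI := a'.charted; letI := b'.charted
    haveI := a'.mfd; haveI := b'.mfd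
    ⟨inferInstance,
      ({ E := a'.E × b'.E, H := ModelProd a'.H b'.H, I := a'.I.prod b'.I } :
        ManifoldAtlas n (M × N))⟩

/-- `C^r` submersions. For topological spaces (`r = -1`): continuous maps with a continuous local
section through every point. -/
def IsSubmersion : {r : Smoothness} → (A : CrStructure r M) → (B : CrStructure r N) →
    (f : M → N) → Prop
  | .negOne, A, B, f => @Continuous M N A.top B.top f ∧
      ∀ m : M, ∃ (V : Set N) (g : N → M), B.IsOpen V ∧ f m ∈ V ∧ g (f m) = m ∧
        (∀ y ∈ V, f (g y) = y) ∧ @ContinuousOn N M B.top A.top g V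
  | .cr n, ⟨tM, a⟩, ⟨tN, b⟩, f =>
    letI := tM; letI := tN
    letI a' : ManifoldAtlas n M := a
    letI b' : ManifoldAtlas n N := b
    letI := a'.charted; letI := b'.charted
    ∀ m : M, Manifold.IsSubmersionAt a'.I b'.I n f m

/-- `C^r` embeddings (topological embeddings for `r = -1`). -/
def IsSmoothEmbedding : {r : Smoothness} → (A : CrStructure r M) → (B : CrStructure r N) →
    (f : M → N) → Prop
  | .negOne, A, B, f => @Topology.IsEmbedding M N A.top B.top f
  | .cr n, ⟨tM, a⟩, ⟨tN, b⟩, f =>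
    letI := tM; letI := tN
    letI a' : ManifoldAtlas n M := a
    letI b' : ManifoldAtlas n N := b
    letI := a'.charted; letI := b'.charted
    (∀ m : M, Manifold.IsImmersionAt a'.I b'.I n f m) ∧ Topology.IsEmbedding f

/-- `S` is a `C^r` submanifold of `M`. -/
def IsSubmanifold (A : CrStructure r M) (S : Set M) : Prop :=
  ∃ B : CrStructure r S, B.IsSmoothEmbedding A Subtype.val

/-- `f`, restricted to `U`, is a partial diffeomorphism: an injective map with open domain and open
range which is smooth and has a smooth inverse. -/
structure IsPartialDiffeo (A : CrStructure r M) (f : M → M) (U : Set M) : Prop where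
  open_domain : A.IsOpen U
  open_range : A.IsOpen (f '' U)
  injOn : Set.InjOn f U
  smooth : A.SmoothOn A f U
  smooth_inv : ∃ g : M → M, Set.LeftInvOn g f U ∧ A.SmoothOn A g (f '' U)

theorem SmoothOn.continuousOn {A : CrStructure r M} {B : CrStructure r N} {f : M → N} {S : Set M}
    (h : A.SmoothOn B f S) : @ContinuousOn M N A.top B.top f S := by
  cases r with
  | negOne => exact h
  | cr n =>
    obtain ⟨tM, a⟩ := A
    obtain ⟨tN, b⟩ := B
    let := tM; let := tN
    let a' : ManifoldAtlas n M := a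
    let b' : ManifoldAtlas n N := b
    let := a'.charted; let := b'.charted
    exact ContMDiffOn.continuousOn (I := a'.I) (I' := b'.I) (n := n) h

theorem SmoothOn.comp {A : CrStructure r M} {B : CrStructure r N} {D : CrStructure r P}
    {g : N → P} {f : M → N} {S : Set M} {T : Set N} (hg : B.SmoothOn D g T)
    (hf : A.SmoothOn B f S) (h : Set.MapsTo f S T) : A.SmoothOn D (g ∘ f) S := by
  cases r with
  | negOne =>
    let := A.top; let := B.top; let := D.top
    exact ContinuousOn.comp (f := f) (g := g) hg hf h
  | cr n =>
    obtain ⟨tM, a⟩ := A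
    obtain ⟨tN, b⟩ := B
    obtain ⟨tP, d⟩ := D
    let := tM; let := tN; let := tP
    let a' : ManifoldAtlas n M := a
    let b' : ManifoldAtlas n N := b
    let d' : ManifoldAtlas n P := d
    let := a'.charted; let := b'.charted; let := d'.charted
    exact ContMDiffOn.comp (I := a'.I) (I' := b'.I) (I'' := d'.I) (n := n) (f := f) (g := g) hg hf h

theorem SmoothOn.mono {A : CrStructure r M} {B : CrStructure r N} {f : M → N} {S T : Set M}
    (h : A.SmoothOn B f S) (hT : T ⊆ S) : A.SmoothOn B f T := by
  cases r with
  | negOne => let := A.top; let := B.top; exact ContinuousOn.mono (f := f) h hT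
  | cr n =>
    obtain ⟨tM, a⟩ := A
    obtain ⟨tN, b⟩ := B
    let := tM; let := tN
    let a' : ManifoldAtlas n M := a
    let b' : ManifoldAtlas n N := b
    let := a'.charted; let := b'.charted
    exact ContMDiffOn.mono (I := a'.I) (I' := b'.I) (n := n) h hT

theorem SmoothOn.congr {A : CrStructure r M} {B : CrStructure r N} {f g : M → N} {S : Set M}
    (h : A.SmoothOn B f S) (hfg : ∀ x ∈ S, g x = f x) : A.SmoothOn B g S := by
  cases r with
  | negOne => let := A.top; let := B.top; exact ContinuousOn.congr (f := f) h hfg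
  | cr n =>
    obtain ⟨tM, a⟩ := A
    obtain ⟨tN, b⟩ := B
    let := tM; let := tN
    let a' : ManifoldAtlas n M := a
    let b' : ManifoldAtlas n N := b
    let := a'.charted; let := b'.charted
    exact ContMDiffOn.congr (I := a'.I) (I' := b'.I) (n := n) h hfg

theorem smoothOn_id (A : CrStructure r M) (S : Set M) : A.SmoothOn A id S := by
  cases r with
  | negOne => let := A.top; exact continuousOn_id
  | cr n =>
    obtain ⟨tM, a⟩ := A
    let := tM
    let a' : ManifoldAtlas n M := a
    let := a'.charted
    exact contMDiffOn_id (I := a'.I) (n := n)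

theorem isOpen_inter_preimage {A : CrStructure r M} {B : CrStructure r N} {f : M → N} {S : Set M}
    {T : Set N} (hf : A.SmoothOn B f S) (hS : A.IsOpen S) (hT : B.IsOpen T) :
    A.IsOpen (S ∩ f ⁻¹' T) := by
  let := A.top; let := B.top
  exact hf.continuousOn.isOpen_inter_preimage hS hT

theorem isOpen_inter {A : CrStructure r M} {S T : Set M} (hS : A.IsOpen S) (hT : A.IsOpen T) :
    A.IsOpen (S ∩ T) := by
  let := A.top
  exact _root_.IsOpen.inter hS hT

theorem isOpen_univ (A : CrStructure r M) : A.IsOpen Set.univ := by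
  let := A.top
  exact _root_.isOpen_univ

theorem isPartialDiffeo_id (A : CrStructure r M) : A.IsPartialDiffeo id Set.univ where
  open_domain := A.isOpen_univ
  open_range := by simpa using A.isOpen_univ
  injOn := Function.injective_id.injOn
  smooth := A.smoothOn_id _
  smooth_inv := ⟨id, fun _ _ => rfl, A.smoothOn_id _⟩

theorem IsPartialDiffeo.congr {A : CrStructure r M} {f g : M → M} {U : Set M}
    (h : A.IsPartialDiffeo f U) (hfg : ∀ x ∈ U, g x = f x) : A.IsPartialDiffeo g U where
  open_domain := h.open_domain
  open_range := by rw [Set.image_congr hfg]; exact h.open_range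
  injOn := h.injOn.congr fun x hx => (hfg x hx).symm
  smooth := h.smooth.congr hfg
  smooth_inv := by
    obtain ⟨k, hk, hk'⟩ := h.smooth_inv
    refine ⟨k, fun x hx => by rw [hfg x hx, hk hx], ?_⟩
    rw [Set.image_congr hfg]; exact hk'

theorem IsPartialDiffeo.comp {A : CrStructure r M} {f g : M → M} {U V : Set M}
    (hf : A.IsPartialDiffeo f V) (hg : A.IsPartialDiffeo g U) :
    A.IsPartialDiffeo (f ∘ g) (U ∩ g ⁻¹' V) := by
  obtain ⟨f', hf', hfs⟩ := hf.smooth_inv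
  obtain ⟨g', hg', hgs⟩ := hg.smooth_inv
  have himg : (f ∘ g) '' (U ∩ g ⁻¹' V) = f '' V ∩ f' ⁻¹' (g '' U) := by
    ext y
    constructor
    · rintro ⟨x, ⟨hx, hxV⟩, rfl⟩
      exact ⟨⟨g x, hxV, rfl⟩, ⟨x, hx, (hf' hxV).symm⟩⟩
    · rintro ⟨⟨z, hz, rfl⟩, ⟨x, hx, hxz⟩⟩
      rw [hf' hz] at hxz
      subst hxz
      exact ⟨x, ⟨hx, hz⟩, rfl⟩
  refine ⟨isOpen_inter_preimage hg.smooth hg.open_domain hf.open_domain, ?_, ?_, ?_, ?_⟩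
  · rw [himg]
    exact isOpen_inter_preimage hfs hf.open_range hg.open_range
  · intro x hx y hy hxy
    exact hg.injOn hx.1 hy.1 (hf.injOn hx.2 hy.2 hxy)
  · exact hf.smooth.comp (hg.smooth.mono Set.inter_subset_left) fun x hx => hx.2
  · refine ⟨g' ∘ f', ?_, ?_⟩
    · intro x hx
      change g' (f' (f (g x))) = x
      rw [hf' hx.2, hg' hx.1]
    · rw [himg]
      exact hgs.comp (hfs.mono Set.inter_subset_left) fun x hx => hx.2

theorem IsPartialDiffeo.symm {A : CrStructure r M} {f g : M → M} {U : Set M}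
    (hf : A.IsPartialDiffeo f U) (hg : Set.LeftInvOn g f U) : A.IsPartialDiffeo g (f '' U) := by
  obtain ⟨k, hk, hks⟩ := hf.smooth_inv
  have himg : g '' (f '' U) = U := hg.image_image
  refine ⟨hf.open_range, by rw [himg]; exact hf.open_domain, ?_, ?_, ?_⟩
  · rintro _ ⟨x, hx, rfl⟩ _ ⟨y, hy, rfl⟩ h
    rw [hg hx, hg hy] at h
    rw [h]
  · refine hks.congr ?_
    rintro _ ⟨x, hx, rfl⟩
    rw [hg hx, hk hx]
  · refine ⟨f, ?_, ?_⟩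
    · rintro _ ⟨x, hx, rfl⟩
      rw [hg hx]
    · rw [himg]
      exact hf.smooth

end CrStructure

/-! ### Groupoids and Lie groupoids

A groupoid on the set `X` is a Mathlib `Groupoid X`. Compositions are diagrammatic: the sum `a + b`
of arrows with `β a = α b` is `a ≫ b`. -/

/-- The set of all arrows of a groupoid on `X`. -/
@[ext]
structure Arr (X : Type u) [Groupoid.{v} X] : Type (max u v) where
  src : X
  tgt : X
  hom : src ⟶ tgt

/-- The arrow `a : x ⟶ y` as an element of the set of all arrows. -/
abbrev Arr.of {X : Type u} [Groupoid.{v} X] {x y : X} (a : x ⟶ y) : Arr X := ⟨x, y, a⟩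

/-- `a + b` is defined and equal to `c`. -/
def Arr.IsSum {X : Type u} [Groupoid.{v} X] (a b c : Arr X) : Prop :=
  ∃ (x y z : X) (f : x ⟶ y) (g : y ⟶ z), a = Arr.of f ∧ b = Arr.of g ∧ c = Arr.of (f ≫ g)

/-- A `C^r` structure on the objects and arrows of a groupoid making it a Lie groupoid. -/
structure LieGroupoid (r : Smoothness) (X : Type u) [Groupoid.{v} X] where
  obj : CrStructure r X
  arr : CrStructure r (Arr X)
  unit_embedding : obj.IsSmoothEmbedding arr (fun x => Arr.of (𝟙 x))
  src_submersion : arr.IsSubmersion obj Arr.src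
  tgt_submersion : arr.IsSubmersion obj Arr.tgt
  /-- The domain of the difference map `(a, b) ↦ a - b` is a submanifold of the product. -/
  diff_submanifold : (arr.prod arr).IsSubmanifold {p | p.1.tgt = p.2.tgt}
  diff_smooth : ∃ D : Arr X × Arr X → Arr X,
    (arr.prod arr).SmoothOn arr D {p | p.1.tgt = p.2.tgt} ∧
    ∀ (x y z : X) (a : x ⟶ z) (b : y ⟶ z), D (Arr.of a, Arr.of b) = Arr.of (a ≫ inv b)

/-! ### Crossed modules and the double groupoid of a crossed module -/

/-- A crossed module of groupoids `δ : C → G` over the object set `X`; `G` is the given groupoid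
on `X`, and the totally intransitive groupoid `C` on `X` is the family of its vertex groups
`C x`. The element `act a c` is `c ^ a`. -/
structure CrossedModule (X : Type u) [Groupoid.{v} X] (C : X → Type w) [∀ x, AddGroup (C x)] where
  δ : ∀ {x : X}, C x → (x ⟶ x)
  δ_add : ∀ {x : X} (c c' : C x), δ (c + c') = δ c ≫ δ c'
  act : ∀ {x y : X}, (x ⟶ y) → C x → C y
  act_add : ∀ {x y : X} (a : x ⟶ y) (c c' : C x), act a (c + c') = act a c + act a c'
  act_comp : ∀ {x y z : X} (a : x ⟶ y) (b : y ⟶ z) (c : C x), act (a ≫ b) c = act b (act a c)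
  act_id : ∀ {x : X} (c : C x), act (𝟙 x) c = c
  δ_act : ∀ {x y : X} (a : x ⟶ y) (c : C x), δ (act a c) = inv a ≫ δ c ≫ a
  act_δ : ∀ {x : X} (c c' : C x), act (δ c') c = -c' + c + c'

section

variable {X : Type u} [Groupoid.{v} X] {C : X → Type w} [∀ x, AddGroup (C x)]

namespace CrossedModule

variable (𝒞 : CrossedModule X C)

theorem act_zero {x y : X} (a : x ⟶ y) : 𝒞.act a 0 = 0 := by
  have h := 𝒞.act_add a 0 0
  simpa using h

theorem act_neg {x y : X} (a : x ⟶ y) (c : C x) : 𝒞.act a (-c) = -𝒞.act a c := by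
  rw [eq_neg_iff_add_eq_zero, ← 𝒞.act_add]
  simp [act_zero]

theorem δ_zero (x : X) : 𝒞.δ (0 : C x) = 𝟙 x := by
  have h := 𝒞.δ_add (0 : C x) 0
  rw [add_zero] at h
  have h2 : 𝒞.δ (0 : C x) ≫ 𝟙 x = 𝒞.δ (0 : C x) ≫ 𝒞.δ 0 := by rw [← h, Category.comp_id]
  exact ((cancel_epi _).1 h2).symm

theorem δ_neg {x : X} (c : C x) : 𝒞.δ (-c) = inv (𝒞.δ c) := by
  apply IsIso.eq_inv_of_hom_inv_id
  rw [← 𝒞.δ_add, add_neg_cancel, δ_zero]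

end CrossedModule

/-- The squares of the double groupoid `D(C)` with top edge `d` and bottom edge `a`: `left`
is the edge `b`, `right` is the edge `c`, and `val` is the element `w₁` of `C`. -/
@[ext]
structure DSquare (𝒞 : CrossedModule X C) (d a : Arr X) where
  left : d.src ⟶ a.src
  right : d.tgt ⟶ a.tgt
  val : C a.tgt
  comm : 𝒞.δ val = inv a.hom ≫ inv left ≫ d.hom ≫ right

namespace DSquare

variable {𝒞 : CrossedModule X C}

/-- The horizontal composition `+₂`. -/
def hcomp {p q q' x y z : X} {d : p ⟶ q} {e : q ⟶ q'} {a : x ⟶ y} {i : y ⟶ z}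
    (s : DSquare 𝒞 (Arr.of d) (Arr.of a)) (t : DSquare 𝒞 (Arr.of e) (Arr.of i))
    (h : s.right = t.left) : DSquare 𝒞 (Arr.of (d ≫ e)) (Arr.of (a ≫ i)) where
  left := s.left
  right := t.right
  val := 𝒞.act i s.val + t.val
  comm := by
    have hs := s.comm
    have ht := t.comm
    dsimp only [Arr.of] at hs ht h ⊢
    rw [𝒞.δ_add, 𝒞.δ_act, hs, ht, h]
    simp

/-- The identity square at `a` for `+₁`. -/
def vid (a : Arr X) : DSquare 𝒞 a a := ⟨𝟙 _, 𝟙 _, 0, by simp [𝒞.δ_zero]⟩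

/-- The vertical composition `+₁`. -/
def vcomp {d a a' : Arr X} (s : DSquare 𝒞 d a) (t : DSquare 𝒞 a a') : DSquare 𝒞 d a' where
  left := s.left ≫ t.left
  right := s.right ≫ t.right
  val := t.val + 𝒞.act t.right s.val
  comm := by rw [𝒞.δ_add, 𝒞.δ_act, s.comm, t.comm]; simp

/-- The vertical inverse `-₁`. -/
def vinv {d a : Arr X} (s : DSquare 𝒞 d a) : DSquare 𝒞 a d where
  left := inv s.left
  right := inv s.right
  val := -𝒞.act (inv s.right) s.val
  comm := by rw [𝒞.δ_neg, 𝒞.δ_act, s.comm]; simp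

end DSquare

/-- The object set (the set of arrows of `G`) of the vertical groupoid structure of `D(C)`. -/
def SqObj (_𝒞 : CrossedModule X C) : Type (max u v) := Arr X

/-- The vertical groupoid structure `(D(C), +₁)` over the set of arrows of `G`: a square has as
source its top edge and as target its bottom edge. -/
instance verticalGroupoid (𝒞 : CrossedModule X C) : Groupoid (SqObj 𝒞) where
  Hom d a := DSquare 𝒞 d a
  id a := DSquare.vid a
  comp s t := s.vcomp t
  id_comp s := by
    apply DSquare.ext <;> simp [DSquare.vid, DSquare.vcomp, 𝒞.act_zero]
  comp_id s := by
    apply DSquare.ext <;> simp [DSquare.vid, DSquare.vcomp, 𝒞.act_id]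
  assoc s t k := by
    apply DSquare.ext <;> simp [DSquare.vcomp, 𝒞.act_add, 𝒞.act_comp, add_assoc]
  inv s := s.vinv
  inv_comp s := by
    apply DSquare.ext <;>
      simp [DSquare.vid, DSquare.vcomp, DSquare.vinv, 𝒞.act_neg, ← 𝒞.act_comp, 𝒞.act_id]
  comp_inv s := by
    apply DSquare.ext <;> simp [DSquare.vid, DSquare.vcomp, DSquare.vinv]

/-! ### Local linear coadmissible sections -/

/-- A pair of partial maps `s₀ : X → G`, `s₁ : G → C` with domains `U₀`, `U₁` and with
`β (s₀ x) = x`, `β (s₁ a) = β a`. (Values outside of the domains are irrelevant.) -/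
structure SectionData (X : Type u) [Groupoid.{v} X] (C : X → Type w) where
  U₀ : Set X
  U₁ : Set (Arr X)
  s₀ : ∀ x : X, Σ p : X, (p ⟶ x)
  s₁ : ∀ {x y : X}, (x ⟶ y) → C y

namespace SectionData

variable (s t : SectionData X C) (𝒞 : CrossedModule X C)

/-- `f₀ x = α (s₀ x)`. -/
def f₀ (x : X) : X := (s.s₀ x).1

/-- `s₀ x` as an arrow. -/
def e (x : X) : s.f₀ x ⟶ x := (s.s₀ x).2

/-- The square `s(a)` with bottom edge `a`, vertical edges `s₀ (α a)`, `s₀ (β a)` and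
element `s₁ a`; its top edge is `f₁ a = s₀ (α a) + a + δ (s₁ a) - s₀ (β a)`. -/
def f₁ {x y : X} (a : x ⟶ y) : s.f₀ x ⟶ s.f₀ y :=
  s.e x ≫ a ≫ 𝒞.δ (s.s₁ a) ≫ inv (s.e y)

/-- The map `f₁ = α₁ s` on the set of all arrows. -/
def F₁ (a : Arr X) : Arr X := Arr.of (s.f₁ 𝒞 a.hom)

/-- The value `s(a)`. -/
def sq (a : Arr X) : DSquare 𝒞 (s.F₁ 𝒞 a) a where
  left := s.e a.src
  right := s.e a.tgt
  val := s.s₁ a.hom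
  comm := by
    change 𝒞.δ _ = inv a.hom ≫ inv (s.e a.src) ≫ (s.f₁ 𝒞 a.hom) ≫ s.e a.tgt
    simp [f₁]

/-- The product `s * t`, i.e. `z ↦ s₀ (f₀ z) + t₀ z` and `z ↦ s (f₁ z) +₁ t z` where
`f₀ = α t₀`, `f₁ = α₁ t`. -/
def mul : SectionData X C where
  U₀ := t.U₀ ∩ t.f₀ ⁻¹' s.U₀
  U₁ := t.U₁ ∩ t.F₁ 𝒞 ⁻¹' s.U₁
  s₀ x := ⟨s.f₀ (t.f₀ x), s.e (t.f₀ x) ≫ t.e x⟩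
  s₁ {_ y} a := t.s₁ a + 𝒞.act (t.e y) (s.s₁ (t.f₁ 𝒞 a))

/-- The constant section `x ↦ 1_x`, `a ↦ 1_a`. -/
def one : SectionData X C where
  U₀ := Set.univ
  U₁ := Set.univ
  s₀ x := ⟨x, 𝟙 x⟩
  s₁ _ := 0

open Classical in
/-- The inverse: `f₀ x ↦ -s₀ x` for `x ∈ U₀`, and `f₁ a ↦ -₁ s a` for `a ∈ U₁`. -/
def symm : SectionData X C where
  U₀ := s.f₀ '' s.U₀
  U₁ := s.F₁ 𝒞 '' s.U₁
  s₀ z := if h : ∃ x ∈ s.U₀, s.f₀ x = z then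
      ⟨h.choose, inv (s.e h.choose) ≫ eqToHom h.choose_spec.2⟩ else ⟨z, 𝟙 z⟩
  s₁ k := if h : ∃ a ∈ s.U₁, s.F₁ 𝒞 a = Arr.of k then
      cast (congrArg (fun b : Arr X => C b.tgt) h.choose_spec.2)
        (-𝒞.act (inv (s.e h.choose.tgt)) (s.s₁ h.choose.hom)) else 0

end SectionData

/-- The pair of partial maps is a local linear (coadmissible) section of `D(C)`. -/
structure IsLocalLinear {r : Smoothness} (𝒞 : CrossedModule X C) (L : LieGroupoid r X)
    (s : SectionData X C) : Prop where
  src_mem : ∀ a ∈ s.U₁, a.src ∈ s.U₀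
  tgt_mem : ∀ a ∈ s.U₁, a.tgt ∈ s.U₀
  /-- `s (a + b) = s a +₂ s b` -/
  linear : ∀ (x y z : X) (a : x ⟶ y) (b : y ⟶ z),
    Arr.of a ∈ s.U₁ → Arr.of b ∈ s.U₁ → Arr.of (a ≫ b) ∈ s.U₁ →
      (⟨_, s.sq 𝒞 (Arr.of (a ≫ b))⟩ : Σ d : Arr X, DSquare 𝒞 d (Arr.of (a ≫ b))) =
        ⟨_, (s.sq 𝒞 (Arr.of a)).hcomp (s.sq 𝒞 (Arr.of b)) rfl⟩
  diffeo₀ : L.obj.IsPartialDiffeo s.f₀ s.U₀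
  diffeo₁ : L.arr.IsPartialDiffeo (s.F₁ 𝒞) s.U₁
  /-- `f₁` is linear -/
  linear_F₁ : ∀ a ∈ s.U₁, ∀ b ∈ s.U₁, ∀ c ∈ s.U₁,
    Arr.IsSum a b c → Arr.IsSum (s.F₁ 𝒞 a) (s.F₁ 𝒞 b) (s.F₁ 𝒞 c)
  /-- the inverse of `f₁` is linear -/
  linear_F₁_inv : ∀ a ∈ s.U₁, ∀ b ∈ s.U₁, ∀ c ∈ s.U₁,
    Arr.IsSum (s.F₁ 𝒞 a) (s.F₁ 𝒞 b) (s.F₁ 𝒞 c) → Arr.IsSum a b c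

namespace SectionData

variable (s t k : SectionData X C) (𝒞 : CrossedModule X C)

theorem e_comp_f₁ {x y : X} (a : x ⟶ y) :
    s.f₁ 𝒞 a ≫ s.e y = s.e x ≫ a ≫ 𝒞.δ (s.s₁ a) := by
  simp [f₁]

theorem one_F₁ (a : Arr X) : (one : SectionData X C).F₁ 𝒞 a = a := by
  have h : (one : SectionData X C).f₁ 𝒞 a.hom = a.hom := by
    change 𝟙 _ ≫ a.hom ≫ 𝒞.δ 0 ≫ inv (𝟙 _) = _
    rw [𝒞.δ_zero]; simp
  calc (one : SectionData X C).F₁ 𝒞 a = ⟨a.src, a.tgt, (one : SectionData X C).f₁ 𝒞 a.hom⟩ := rfl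
    _ = a := by rw [h]

theorem mul_f₁ {x y : X} (a : x ⟶ y) : (s.mul t 𝒞).f₁ 𝒞 a = s.f₁ 𝒞 (t.f₁ 𝒞 a) := by
  change (s.e (t.f₀ x) ≫ t.e x) ≫ a ≫ 𝒞.δ (t.s₁ a + 𝒞.act (t.e y) (s.s₁ (t.f₁ 𝒞 a))) ≫
    inv (s.e (t.f₀ y) ≫ t.e y) = s.e _ ≫ t.f₁ 𝒞 a ≫ 𝒞.δ (s.s₁ (t.f₁ 𝒞 a)) ≫ inv (s.e _)
  rw [𝒞.δ_add, 𝒞.δ_act]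
  generalize s.s₁ (t.f₁ 𝒞 a) = c
  simp [f₁]

theorem mul_F₁ (a : Arr X) : (s.mul t 𝒞).F₁ 𝒞 a = s.F₁ 𝒞 (t.F₁ 𝒞 a) := by
  change (⟨s.f₀ (t.f₀ a.src), s.f₀ (t.f₀ a.tgt), (s.mul t 𝒞).f₁ 𝒞 a.hom⟩ : Arr X) = _
  rw [mul_f₁]; rfl

theorem linear_iff {x y z : X} (a : x ⟶ y) (b : y ⟶ z) :
    ((⟨_, s.sq 𝒞 (Arr.of (a ≫ b))⟩ : Σ d : Arr X, DSquare 𝒞 d (Arr.of (a ≫ b))) =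
        ⟨_, (s.sq 𝒞 (Arr.of a)).hcomp (s.sq 𝒞 (Arr.of b)) rfl⟩) ↔
      s.s₁ (a ≫ b) = 𝒞.act b (s.s₁ a) + s.s₁ b := by
  constructor
  · intro h
    exact congrArg (fun p : Σ d : Arr X, DSquare 𝒞 d (Arr.of (a ≫ b)) => p.2.val) h
  · intro h
    have hd : s.f₁ 𝒞 (a ≫ b) = s.f₁ 𝒞 a ≫ s.f₁ 𝒞 b := by
      simp [f₁, h, 𝒞.δ_add, 𝒞.δ_act]
    have key : ∀ (d d' : s.f₀ x ⟶ s.f₀ z) (c c' : C z) (p p'), d = d' → c = c' →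
        (⟨Arr.of d, ⟨s.e x, s.e z, c, p⟩⟩ : Σ d : Arr X, DSquare 𝒞 d (Arr.of (a ≫ b))) =
          ⟨Arr.of d', ⟨s.e x, s.e z, c', p'⟩⟩ := by
      rintro d _ c _ p p' rfl rfl
      rfl
    exact key _ _ _ _ _ _ hd h

theorem linear_f₁ {x y z : X} {a : x ⟶ y} {b : y ⟶ z}
    (h : s.s₁ (a ≫ b) = 𝒞.act b (s.s₁ a) + s.s₁ b) :
    s.f₁ 𝒞 (a ≫ b) = s.f₁ 𝒞 a ≫ s.f₁ 𝒞 b := by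
  simp [f₁, h, 𝒞.δ_add, 𝒞.δ_act]

variable {s t k 𝒞}

open Classical in
theorem symm_s₀ (hs : Set.InjOn s.f₀ s.U₀) {x : X} (hx : x ∈ s.U₀) :
    (s.symm 𝒞).s₀ (s.f₀ x) = ⟨x, inv (s.e x)⟩ := by
  have h : ∃ x' ∈ s.U₀, s.f₀ x' = s.f₀ x := ⟨x, hx, rfl⟩
  have hc : h.choose = x := hs h.choose_spec.1 hx h.choose_spec.2
  have key : ∀ (x' : X) (hx' : x' = x) (h' : s.f₀ x' = s.f₀ x),
      (⟨x', inv (s.e x') ≫ eqToHom h'⟩ : Σ p : X, (p ⟶ s.f₀ x)) = ⟨x, inv (s.e x)⟩ := by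
    rintro _ rfl h'
    simp
  change (if h : ∃ x' ∈ s.U₀, s.f₀ x' = s.f₀ x then
      (⟨h.choose, inv (s.e h.choose) ≫ eqToHom h.choose_spec.2⟩ : Σ p : X, (p ⟶ s.f₀ x))
      else ⟨s.f₀ x, 𝟙 _⟩) = _
  rw [dif_pos h]
  exact key _ hc _

open Classical in
theorem symm_s₁ (hs : Set.InjOn (s.F₁ 𝒞) s.U₁) {x y : X} (a : x ⟶ y) (ha : Arr.of a ∈ s.U₁) :
    (s.symm 𝒞).s₁ (s.f₁ 𝒞 a) = -𝒞.act (inv (s.e y)) (s.s₁ a) := by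
  have h : ∃ b ∈ s.U₁, s.F₁ 𝒞 b = Arr.of (s.f₁ 𝒞 a) := ⟨Arr.of a, ha, rfl⟩
  have hc : h.choose = Arr.of a := hs h.choose_spec.1 ha h.choose_spec.2
  have key : ∀ (b : Arr X) (hb : b = Arr.of a) (h' : C (s.F₁ 𝒞 b).tgt = C (s.f₀ y)),
      cast h' (-𝒞.act (inv (s.e b.tgt)) (s.s₁ b.hom)) = -𝒞.act (inv (s.e y)) (s.s₁ a) := by
    rintro _ rfl h'
    rfl
  change (if h : ∃ b ∈ s.U₁, s.F₁ 𝒞 b = Arr.of (s.f₁ 𝒞 a) then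
      cast (congrArg (fun b : Arr X => C b.tgt) h.choose_spec.2)
        (-𝒞.act (inv (s.e h.choose.tgt)) (s.s₁ h.choose.hom)) else 0) = _
  rw [dif_pos h]
  exact key _ hc _

theorem symm_F₁ (h₀ : Set.InjOn s.f₀ s.U₀) (h₁ : Set.InjOn (s.F₁ 𝒞) s.U₁) {a : Arr X}
    (ha : a ∈ s.U₁) (hsrc : a.src ∈ s.U₀) (htgt : a.tgt ∈ s.U₀) :
    (s.symm 𝒞).F₁ 𝒞 (s.F₁ 𝒞 a) = a := by
  obtain ⟨x, y, a⟩ := a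
  have key : ∀ (p : Σ p : X, (p ⟶ s.f₀ x)) (q : Σ p : X, (p ⟶ s.f₀ y)) (c : C (s.f₀ y)),
      p = ⟨x, inv (s.e x)⟩ → q = ⟨y, inv (s.e y)⟩ → c = -𝒞.act (inv (s.e y)) (s.s₁ a) →
      (⟨p.1, q.1, p.2 ≫ s.f₁ 𝒞 a ≫ 𝒞.δ c ≫ inv q.2⟩ : Arr X) = ⟨x, y, a⟩ := by
    rintro _ _ _ rfl rfl rfl
    simp [f₁, 𝒞.δ_neg, 𝒞.δ_act]
  exact key _ _ _ (symm_s₀ h₀ hsrc) (symm_s₀ h₀ htgt) (symm_s₁ h₁ a ha)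

end SectionData

namespace IsLocalLinear

variable {r : Smoothness} {𝒞 : CrossedModule X C} {L : LieGroupoid r X} {s t : SectionData X C}

theorem one : IsLocalLinear 𝒞 L (SectionData.one : SectionData X C) where
  src_mem _ _ := trivial
  tgt_mem _ _ := trivial
  linear x y z a b _ _ _ := by
    rw [SectionData.linear_iff]
    change 0 = 𝒞.act b 0 + 0
    rw [𝒞.act_zero, add_zero]
  diffeo₀ := L.obj.isPartialDiffeo_id
  diffeo₁ := L.arr.isPartialDiffeo_id.congr fun a _ => SectionData.one_F₁ 𝒞 a
  linear_F₁ a _ b _ c _ h := by simpa only [SectionData.one_F₁] using h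
  linear_F₁_inv a _ b _ c _ h := by simpa only [SectionData.one_F₁] using h

theorem linear' (hs : IsLocalLinear 𝒞 L s) {x y z : X} {a : x ⟶ y} {b : y ⟶ z}
    (ha : Arr.of a ∈ s.U₁) (hb : Arr.of b ∈ s.U₁) (hc : Arr.of (a ≫ b) ∈ s.U₁) :
    s.s₁ (a ≫ b) = 𝒞.act b (s.s₁ a) + s.s₁ b :=
  (s.linear_iff 𝒞 a b).1 (hs.linear x y z a b ha hb hc)

theorem mul (hs : IsLocalLinear 𝒞 L s) (ht : IsLocalLinear 𝒞 L t) :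
    IsLocalLinear 𝒞 L (s.mul t 𝒞) where
  src_mem a ha := ⟨ht.src_mem a ha.1, hs.src_mem _ ha.2⟩
  tgt_mem a ha := ⟨ht.tgt_mem a ha.1, hs.tgt_mem _ ha.2⟩
  linear x y z a b ha hb hab := by
    rw [SectionData.linear_iff]
    have h1 := ht.linear' ha.1 hb.1 hab.1
    have h2 := t.linear_f₁ 𝒞 h1
    have hab2 : Arr.of (t.f₁ 𝒞 (a ≫ b)) ∈ s.U₁ := hab.2
    rw [h2] at hab2
    have h3 := hs.linear' (a := t.f₁ 𝒞 a) (b := t.f₁ 𝒞 b) ha.2 hb.2 hab2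
    change t.s₁ (a ≫ b) + 𝒞.act (t.e z) (s.s₁ (t.f₁ 𝒞 (a ≫ b))) =
      𝒞.act b (t.s₁ a + 𝒞.act (t.e y) (s.s₁ (t.f₁ 𝒞 a))) +
        (t.s₁ b + 𝒞.act (t.e z) (s.s₁ (t.f₁ 𝒞 b)))
    rw [h2, h3, h1, 𝒞.act_add, 𝒞.act_add, ← 𝒞.act_comp, t.e_comp_f₁, 𝒞.act_comp, 𝒞.act_comp,
      𝒞.act_δ]
    simp [add_assoc]
  diffeo₀ := hs.diffeo₀.comp ht.diffeo₀
  diffeo₁ := (hs.diffeo₁.comp ht.diffeo₁).congr fun a _ => s.mul_F₁ t 𝒞 a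
  linear_F₁ a ha b hb c hc h := by
    simp only [SectionData.mul_F₁]
    exact hs.linear_F₁ _ ha.2 _ hb.2 _ hc.2 (ht.linear_F₁ _ ha.1 _ hb.1 _ hc.1 h)
  linear_F₁_inv a ha b hb c hc h := by
    simp only [SectionData.mul_F₁] at h
    exact ht.linear_F₁_inv _ ha.1 _ hb.1 _ hc.1 (hs.linear_F₁_inv _ ha.2 _ hb.2 _ hc.2 h)

theorem symm_f₀ (hs : IsLocalLinear 𝒞 L s) {x : X} (hx : x ∈ s.U₀) :
    (s.symm 𝒞).f₀ (s.f₀ x) = x :=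
  congrArg Sigma.fst (SectionData.symm_s₀ (𝒞 := 𝒞) hs.diffeo₀.injOn hx)

theorem symm_F₁ (hs : IsLocalLinear 𝒞 L s) {a : Arr X} (ha : a ∈ s.U₁) :
    (s.symm 𝒞).F₁ 𝒞 (s.F₁ 𝒞 a) = a :=
  SectionData.symm_F₁ hs.diffeo₀.injOn hs.diffeo₁.injOn ha (hs.src_mem a ha) (hs.tgt_mem a ha)

theorem symm_linear (hs : IsLocalLinear 𝒞 L s) {u v w : Arr X} (hu : u ∈ s.U₁) (hv : v ∈ s.U₁)
    (hw : w ∈ s.U₁) {x y z : X} (a : x ⟶ y) (b : y ⟶ z) (ha : s.F₁ 𝒞 u = Arr.of a)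
    (hb : s.F₁ 𝒞 v = Arr.of b) (hab : s.F₁ 𝒞 w = Arr.of (a ≫ b)) :
    (s.symm 𝒞).s₁ (a ≫ b) = 𝒞.act b ((s.symm 𝒞).s₁ a) + (s.symm 𝒞).s₁ b := by
  obtain ⟨x', y', z', f, g, rfl, rfl, rfl⟩ := hs.linear_F₁_inv u hu v hv w hw
    ⟨x, y, z, a, b, ha, hb, hab⟩
  obtain ⟨rfl, h⟩ := Arr.mk.inj ha
  obtain ⟨rfl, h⟩ := h
  obtain rfl := eq_of_heq h
  obtain ⟨h1, h⟩ := Arr.mk.inj hb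
  obtain ⟨rfl, h⟩ := h
  obtain rfl := eq_of_heq h
  have hl := hs.linear' hu hv hw
  have hf := s.linear_f₁ 𝒞 hl
  have e1 := SectionData.symm_s₁ hs.diffeo₁.injOn f hu
  have e2 := SectionData.symm_s₁ hs.diffeo₁.injOn g hv
  have e3 := SectionData.symm_s₁ hs.diffeo₁.injOn (f ≫ g) hw
  rw [hf] at e3
  change (s.symm 𝒞).s₁ (s.f₁ 𝒞 f ≫ s.f₁ 𝒞 g) =
    𝒞.act (s.f₁ 𝒞 g) ((s.symm 𝒞).s₁ (s.f₁ 𝒞 f)) + (s.symm 𝒞).s₁ (s.f₁ 𝒞 g)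
  rw [e1, e2, e3, hl, 𝒞.act_add, ← 𝒞.act_comp, 𝒞.act_neg, ← 𝒞.act_comp]
  have e4 : inv (s.e y') ≫ s.f₁ 𝒞 g = g ≫ 𝒞.δ (s.s₁ g) ≫ inv (s.e z') := by
    simp [SectionData.f₁]
  rw [e4, 𝒞.act_comp, 𝒞.act_comp, 𝒞.act_comp, 𝒞.act_δ]
  simp [𝒞.act_add, 𝒞.act_neg, add_assoc]

theorem symm (hs : IsLocalLinear 𝒞 L s) : IsLocalLinear 𝒞 L (s.symm 𝒞) where
  src_mem := by
    rintro _ ⟨a, ha, rfl⟩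
    exact ⟨a.src, hs.src_mem a ha, rfl⟩
  tgt_mem := by
    rintro _ ⟨a, ha, rfl⟩
    exact ⟨a.tgt, hs.tgt_mem a ha, rfl⟩
  linear x y z a b := by
    rintro ⟨u, hu, ha⟩ ⟨v, hv, hb⟩ ⟨w, hw, hab⟩
    rw [SectionData.linear_iff]
    exact hs.symm_linear hu hv hw a b ha hb hab
  diffeo₀ := hs.diffeo₀.symm fun _ hx => hs.symm_f₀ hx
  diffeo₁ := hs.diffeo₁.symm fun _ ha => hs.symm_F₁ ha
  linear_F₁ := by
    rintro _ ⟨a, ha, rfl⟩ _ ⟨b, hb, rfl⟩ _ ⟨c, hc, rfl⟩ h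
    rw [hs.symm_F₁ ha, hs.symm_F₁ hb, hs.symm_F₁ hc]
    exact hs.linear_F₁_inv a ha b hb c hc h
  linear_F₁_inv := by
    rintro _ ⟨a, ha, rfl⟩ _ ⟨b, hb, rfl⟩ _ ⟨c, hc, rfl⟩ h
    rw [hs.symm_F₁ ha, hs.symm_F₁ hb, hs.symm_F₁ hc] at h
    exact hs.linear_F₁ a ha b hb c hc h

end IsLocalLinear

/-! ### Germs and the final map -/

section

variable {r : Smoothness}

/-- `s` and `t` have the same germ at `a`. -/
def SameGerm (L : LieGroupoid r X) (a : Arr X) (s t : SectionData X C) : Prop :=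
  ∃ (V₀ : Set X) (V₁ : Set (Arr X)), L.obj.IsOpen V₀ ∧ L.arr.IsOpen V₁ ∧ a ∈ V₁ ∧
    V₀ ⊆ s.U₀ ∩ t.U₀ ∧ V₁ ⊆ s.U₁ ∩ t.U₁ ∧ (∀ b ∈ V₁, b.src ∈ V₀ ∧ b.tgt ∈ V₀) ∧
    (∀ x ∈ V₀, s.s₀ x = t.s₀ x) ∧
    ∀ (x y : X) (b : x ⟶ y), Arr.of b ∈ V₁ → s.s₁ b = t.s₁ b

/-- Local linear sections `s` defined at `a`, with `f₁ a = b`. -/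
def SectionAt (𝒞 : CrossedModule X C) (L : LieGroupoid r X) (b a : Arr X) :=
  {s : SectionData X C // IsLocalLinear 𝒞 L s ∧ a ∈ s.U₁ ∧ s.F₁ 𝒞 a = b}

namespace SameGerm

variable {𝒞 : CrossedModule X C} {L : LieGroupoid r X} {a b c : Arr X} {s s' t t' : SectionData X C}

theorem refl (hs : IsLocalLinear 𝒞 L s) (ha : a ∈ s.U₁) : SameGerm L a s s :=
  ⟨s.U₀, s.U₁, hs.diffeo₀.open_domain, hs.diffeo₁.open_domain, ha, fun _ h => ⟨h, h⟩,
    fun _ h => ⟨h, h⟩, fun b hb => ⟨hs.src_mem b hb, hs.tgt_mem b hb⟩, fun _ _ => rfl,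
    fun _ _ _ _ => rfl⟩

theorem symm (h : SameGerm L a s t) : SameGerm L a t s := by
  obtain ⟨V₀, V₁, h0, h1, ha, hV0, hV1, hm, e0, e1⟩ := h
  exact ⟨V₀, V₁, h0, h1, ha, fun x hx => (hV0 hx).symm, fun x hx => (hV1 hx).symm, hm,
    fun x hx => (e0 x hx).symm, fun x y b hb => (e1 x y b hb).symm⟩

theorem trans (h : SameGerm L a s t) (h' : SameGerm L a t t') : SameGerm L a s t' := by
  obtain ⟨V₀, V₁, h0, h1, ha, hV0, hV1, hm, e0, e1⟩ := h
  obtain ⟨V₀', V₁', h0', h1', ha', hV0', hV1', hm', e0', e1'⟩ := h'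
  exact ⟨V₀ ∩ V₀', V₁ ∩ V₁', CrStructure.isOpen_inter h0 h0', CrStructure.isOpen_inter h1 h1',
    ⟨ha, ha'⟩, fun x hx => ⟨(hV0 hx.1).1, (hV0' hx.2).2⟩, fun x hx => ⟨(hV1 hx.1).1, (hV1' hx.2).2⟩,
    fun b hb => ⟨⟨(hm b hb.1).1, (hm' b hb.2).1⟩, ⟨(hm b hb.1).2, (hm' b hb.2).2⟩⟩,
    fun x hx => (e0 x hx.1).trans (e0' x hx.2),
    fun x y b hb => (e1 x y b hb.1).trans (e1' x y b hb.2)⟩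

/-- Equal values of `s` and `t` at `a`. -/
theorem sq_eq_of (a : Arr X) (h0 : s.s₀ a.src = t.s₀ a.src) (h0' : s.s₀ a.tgt = t.s₀ a.tgt)
    (h1 : s.s₁ a.hom = t.s₁ a.hom) :
    (⟨_, s.sq 𝒞 a⟩ : Σ d : Arr X, DSquare 𝒞 d a) = ⟨_, t.sq 𝒞 a⟩ := by
  have key : ∀ (p p' : Σ p : X, (p ⟶ a.src)) (q q' : Σ q : X, (q ⟶ a.tgt)) (c c' : C a.tgt)
      (h h'), p = p' → q = q' → c = c' →
      (⟨⟨p.1, q.1, p.2 ≫ a.hom ≫ 𝒞.δ c ≫ inv q.2⟩, ⟨p.2, q.2, c, h⟩⟩ :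
        Σ d : Arr X, DSquare 𝒞 d a) =
      ⟨⟨p'.1, q'.1, p'.2 ≫ a.hom ≫ 𝒞.δ c' ≫ inv q'.2⟩, ⟨p'.2, q'.2, c', h'⟩⟩ := by
    rintro p _ q _ c _ h h' rfl rfl rfl
    rfl
  exact key _ _ _ _ _ _ _ _ h0 h0' h1

theorem sq_eq (h : SameGerm L a s t) :
    (⟨_, s.sq 𝒞 a⟩ : Σ d : Arr X, DSquare 𝒞 d a) = ⟨_, t.sq 𝒞 a⟩ := by
  obtain ⟨V₀, V₁, _, _, ha, _, _, hm, e0, e1⟩ := h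
  exact sq_eq_of a (e0 _ (hm a ha).1) (e0 _ (hm a ha).2) (e1 _ _ a.hom ha)

theorem mul (ht' : IsLocalLinear 𝒞 L t) (hc : t.F₁ 𝒞 a = b)
    (h : SameGerm L b s s') (h' : SameGerm L a t t') :
    SameGerm L a (s.mul t 𝒞) (s'.mul t' 𝒞) := by
  obtain ⟨V₀, V₁, h0, h1, ha, hV0, hV1, hm, e0, e1⟩ := h
  obtain ⟨V₀', V₁', h0', h1', ha', hV0', hV1', hm', e0', e1'⟩ := h'
  have q0 : L.obj.IsOpen (V₀' ∩ t.f₀ ⁻¹' V₀) :=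
    CrStructure.isOpen_inter_preimage (ht'.diffeo₀.smooth.mono fun x hx => (hV0' hx).1) h0' h0
  have q1 : L.arr.IsOpen (V₁' ∩ t.F₁ 𝒞 ⁻¹' V₁) :=
    CrStructure.isOpen_inter_preimage (ht'.diffeo₁.smooth.mono fun x hx => (hV1' hx).1) h1' h1
  have f0 : ∀ x ∈ V₀', t.f₀ x = t'.f₀ x := fun x hx => congrArg Sigma.fst (e0' x hx)
  have f1 : ∀ b ∈ V₁', t.F₁ 𝒞 b = t'.F₁ 𝒞 b := fun b hb =>
    congrArg Sigma.fst (sq_eq_of (𝒞 := 𝒞) b (e0' _ (hm' b hb).1) (e0' _ (hm' b hb).2)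
      (e1' _ _ b.hom hb))
  refine ⟨_, _, q0, q1, ⟨ha', by rw [Set.mem_preimage, hc]; exact ha⟩, ?_, ?_, ?_, ?_, ?_⟩
  · rintro x ⟨hx, hx'⟩
    refine ⟨⟨(hV0' hx).1, (hV0 hx').1⟩, (hV0' hx).2, ?_⟩
    rw [Set.mem_preimage, ← f0 x hx]
    exact (hV0 hx').2
  · rintro x ⟨hx, hx'⟩
    refine ⟨⟨(hV1' hx).1, (hV1 hx').1⟩, (hV1' hx).2, ?_⟩
    rw [Set.mem_preimage, ← f1 x hx]
    exact (hV1 hx').2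
  · rintro b ⟨hb, hb'⟩
    exact ⟨⟨(hm' b hb).1, (hm _ hb').1⟩, ⟨(hm' b hb).2, (hm _ hb').2⟩⟩
  · rintro x ⟨hx, hx'⟩
    have key : ∀ p p' : Σ p : X, (p ⟶ x), p = p' → s.s₀ p.1 = s'.s₀ p.1 →
        (⟨(s.s₀ p.1).1, (s.s₀ p.1).2 ≫ p.2⟩ : Σ p : X, (p ⟶ x)) =
          ⟨(s'.s₀ p'.1).1, (s'.s₀ p'.1).2 ≫ p'.2⟩ := by
      rintro p _ rfl h
      rw [h]
    exact key _ _ (e0' x hx) (e0 _ hx')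
  · rintro x y b ⟨hb, hb'⟩
    have key : ∀ (p p' : Σ p : X, (p ⟶ x)) (q q' : Σ q : X, (q ⟶ y)) (c c' : C y),
      p = p' → q = q' → c = c' →
      (s.s₁ (p.2 ≫ b ≫ 𝒞.δ c ≫ inv q.2) = s'.s₁ (p.2 ≫ b ≫ 𝒞.δ c ≫ inv q.2)) →
      c + 𝒞.act q.2 (s.s₁ (p.2 ≫ b ≫ 𝒞.δ c ≫ inv q.2)) =
        c' + 𝒞.act q'.2 (s'.s₁ (p'.2 ≫ b ≫ 𝒞.δ c' ≫ inv q'.2)) := by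
      rintro p _ q _ c _ rfl rfl rfl h
      rw [h]
    exact key _ _ _ _ _ _ (e0' x (hm' _ hb).1) (e0' y (hm' _ hb).2) (e1' _ _ b hb)
      (e1 _ _ (t.f₁ 𝒞 b) hb')

/-- Sections which agree on a common open domain have the same germs. -/
theorem of_eqOn (hs : IsLocalLinear 𝒞 L s) (ha : a ∈ s.U₁) (h0 : s.U₀ ⊆ t.U₀) (h1 : s.U₁ ⊆ t.U₁)
    (e0 : ∀ x ∈ s.U₀, s.s₀ x = t.s₀ x)
    (e1 : ∀ (x y : X) (b : x ⟶ y), Arr.of b ∈ s.U₁ → s.s₁ b = t.s₁ b) : SameGerm L a s t :=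
  ⟨s.U₀, s.U₁, hs.diffeo₀.open_domain, hs.diffeo₁.open_domain, ha, fun _ h => ⟨h, h0 h⟩,
    fun _ h => ⟨h, h1 h⟩, fun b hb => ⟨hs.src_mem b hb, hs.tgt_mem b hb⟩, e0, e1⟩

end SameGerm

instance germSetoid (𝒞 : CrossedModule X C) (L : LieGroupoid r X) (b a : Arr X) :
    Setoid (SectionAt 𝒞 L b a) where
  r s t := SameGerm L a s.1 t.1
  iseqv :=
    { refl := fun s => SameGerm.refl s.2.1 s.2.2.1
      symm := SameGerm.symm
      trans := SameGerm.trans }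

/-- The object set (the set of arrows of `G`) of the groupoid of germs. -/
def GermObj (_𝒞 : CrossedModule X C) (_L : LieGroupoid r X) : Type (max u v) := Arr X

namespace SectionAt

variable {𝒞 : CrossedModule X C} {L : LieGroupoid r X} {a b c d : Arr X}

def one (a : Arr X) : SectionAt 𝒞 L a a :=
  ⟨SectionData.one, IsLocalLinear.one, trivial, SectionData.one_F₁ 𝒞 a⟩

def mul (s : SectionAt 𝒞 L c b) (t : SectionAt 𝒞 L b a) : SectionAt 𝒞 L c a :=
  ⟨s.1.mul t.1 𝒞, s.2.1.mul t.2.1,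
    ⟨t.2.2.1, by rw [Set.mem_preimage, t.2.2.2]; exact s.2.2.1⟩,
    by rw [SectionData.mul_F₁, t.2.2.2, s.2.2.2]⟩

def symm (s : SectionAt 𝒞 L b a) : SectionAt 𝒞 L a b :=
  ⟨s.1.symm 𝒞, s.2.1.symm, ⟨a, s.2.2.1, s.2.2.2⟩, by
    have h := s.2.1.symm_F₁ s.2.2.1
    rw [s.2.2.2] at h
    exact h⟩

theorem mul_congr {s s' : SectionAt 𝒞 L c b} {t t' : SectionAt 𝒞 L b a} (h : s ≈ s')
    (h' : t ≈ t') : s.mul t ≈ s'.mul t' :=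
  SameGerm.mul t.2.1 t.2.2.2 h h'

theorem one_mul (s : SectionAt 𝒞 L b a) : (one b).mul s ≈ s := by
  refine SameGerm.of_eqOn (((one b).mul s).2.1) (((one b).mul s).2.2.1) (fun x hx => hx.1)
    (fun x hx => hx.1) (fun x _ => ?_) (fun x y k _ => ?_)
  · change (⟨s.1.f₀ x, 𝟙 _ ≫ s.1.e x⟩ : Σ p : X, (p ⟶ x)) = s.1.s₀ x
    rw [Category.id_comp]; rfl
  · change s.1.s₁ k + 𝒞.act (s.1.e y) 0 = s.1.s₁ k
    rw [𝒞.act_zero, add_zero]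

theorem mul_one (s : SectionAt 𝒞 L b a) : s.mul (one a) ≈ s := by
  have hF : ∀ {x y : X} (k : x ⟶ y), (SectionData.one : SectionData X C).f₁ 𝒞 k = k := by
    intro x y k
    change 𝟙 _ ≫ k ≫ 𝒞.δ 0 ≫ inv (𝟙 _) = _
    rw [𝒞.δ_zero]; simp
  refine SameGerm.of_eqOn ((s.mul (one a)).2.1) ((s.mul (one a)).2.2.1) (fun x hx => hx.2)
    (fun x hx => ?_) (fun x _ => ?_) (fun x y k _ => ?_)
  · have h := hx.2
    rw [Set.mem_preimage] at h
    exact (SectionData.one_F₁ 𝒞 x) ▸ h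
  · change (⟨s.1.f₀ x, s.1.e x ≫ 𝟙 x⟩ : Σ p : X, (p ⟶ x)) = s.1.s₀ x
    rw [Category.comp_id]; rfl
  · change 0 + 𝒞.act (𝟙 y) (s.1.s₁ ((SectionData.one : SectionData X C).f₁ 𝒞 k)) = s.1.s₁ k
    rw [𝒞.act_id, zero_add, hF]; rfl

theorem mul_assoc (s : SectionAt 𝒞 L d c) (t : SectionAt 𝒞 L c b) (k : SectionAt 𝒞 L b a) :
    (s.mul t).mul k ≈ s.mul (t.mul k) := by
  refine SameGerm.of_eqOn (((s.mul t).mul k).2.1) (((s.mul t).mul k).2.2.1)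
    (fun x hx => ⟨⟨hx.1, hx.2.1⟩, hx.2.2⟩) (fun x hx => ⟨⟨hx.1, hx.2.1⟩, ?_⟩)
    (fun x _ => ?_) (fun x y l _ => ?_)
  · have h := hx.2.2
    change (t.1.mul k.1 𝒞).F₁ 𝒞 x ∈ s.1.U₁
    rw [SectionData.mul_F₁]
    exact h
  · change (⟨_, (s.1.e _ ≫ t.1.e (k.1.f₀ x)) ≫ k.1.e x⟩ : Σ p : X, (p ⟶ x)) =
      ⟨_, s.1.e _ ≫ t.1.e (k.1.f₀ x) ≫ k.1.e x⟩
    rw [Category.assoc]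
  · change k.1.s₁ l + 𝒞.act (k.1.e y) (t.1.s₁ (k.1.f₁ 𝒞 l) +
        𝒞.act (t.1.e (k.1.f₀ y)) (s.1.s₁ (t.1.f₁ 𝒞 (k.1.f₁ 𝒞 l)))) =
      (k.1.s₁ l + 𝒞.act (k.1.e y) (t.1.s₁ (k.1.f₁ 𝒞 l))) +
        𝒞.act (t.1.e (k.1.f₀ y) ≫ k.1.e y) (s.1.s₁ ((t.1.mul k.1 𝒞).f₁ 𝒞 l))
    rw [SectionData.mul_f₁, 𝒞.act_add, 𝒞.act_comp, add_assoc]; rfl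

theorem symm_mul (s : SectionAt 𝒞 L b a) : s.symm.mul s ≈ one a := by
  refine SameGerm.of_eqOn ((s.symm.mul s).2.1) ((s.symm.mul s).2.2.1) (fun x _ => trivial)
    (fun x _ => trivial) (fun x hx => ?_) (fun x y k hk => ?_)
  · have key : ∀ p : Σ p : X, (p ⟶ s.1.f₀ x), p = ⟨x, inv (s.1.e x)⟩ →
        (⟨p.1, p.2 ≫ s.1.e x⟩ : Σ p : X, (p ⟶ x)) = ⟨x, 𝟙 x⟩ := by
      rintro _ rfl
      simp
    exact key _ (SectionData.symm_s₀ s.2.1.diffeo₀.injOn hx.1)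
  · change s.1.s₁ k + 𝒞.act (s.1.e y) ((s.1.symm 𝒞).s₁ (s.1.f₁ 𝒞 k)) = 0
    rw [SectionData.symm_s₁ s.2.1.diffeo₁.injOn k hk.1, 𝒞.act_neg, ← 𝒞.act_comp]
    simp [𝒞.act_id]

theorem mul_symm (s : SectionAt 𝒞 L b a) : s.mul s.symm ≈ one b := by
  refine SameGerm.of_eqOn ((s.mul s.symm).2.1) ((s.mul s.symm).2.2.1) (fun x _ => trivial)
    (fun x _ => trivial) (fun z hz => ?_) (fun z z' k hk => ?_)
  · obtain ⟨x, hx, rfl⟩ := hz.1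
    have key : ∀ p : Σ p : X, (p ⟶ s.1.f₀ x), p = ⟨x, inv (s.1.e x)⟩ →
        (⟨s.1.f₀ p.1, s.1.e p.1 ≫ p.2⟩ : Σ p : X, (p ⟶ s.1.f₀ x)) = ⟨s.1.f₀ x, 𝟙 _⟩ := by
      rintro _ rfl
      simp
    exact key _ (SectionData.symm_s₀ s.2.1.diffeo₀.injOn hx)
  · obtain ⟨⟨x, y, l⟩, hl, h⟩ := hk.1
    obtain ⟨rfl, h⟩ := Arr.mk.inj h
    obtain ⟨rfl, h⟩ := h
    obtain rfl := eq_of_heq h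
    have hF := s.2.1.symm_F₁ hl
    have hs := SectionData.symm_s₀ (𝒞 := 𝒞) s.2.1.diffeo₀.injOn (s.2.1.tgt_mem _ hl)
    have h1 := SectionData.symm_s₁ s.2.1.diffeo₁.injOn l hl
    have key : ∀ (b : Arr X) (q : b.tgt ⟶ s.1.f₀ y) (c : C (s.1.f₀ y)), b = Arr.of l →
        (⟨b.tgt, q⟩ : Σ p : X, (p ⟶ s.1.f₀ y)) = ⟨y, inv (s.1.e y)⟩ →
        c = -𝒞.act (inv (s.1.e y)) (s.1.s₁ l) →
        c + 𝒞.act q (s.1.s₁ b.hom) = 0 := by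
      rintro _ q _ rfl hq rfl
      obtain rfl : q = inv (s.1.e y) := by
        obtain ⟨_, h⟩ := Sigma.mk.inj hq
        exact eq_of_heq h
      simp
    exact key ((s.1.symm 𝒞).F₁ 𝒞 (Arr.of (s.1.f₁ 𝒞 l))) ((s.1.symm 𝒞).e (s.1.f₀ y)) _ hF hs h1

theorem symm_congr {s t : SectionAt 𝒞 L b a} (h : s ≈ t) : s.symm ≈ t.symm := by
  have h1 : t.symm.mul s ≈ one a := Setoid.trans (mul_congr (Setoid.refl _) h) t.symm_mul
  have h2 : (t.symm.mul s).mul s.symm ≈ t.symm :=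
    Setoid.trans (t.symm.mul_assoc s s.symm)
      (Setoid.trans (mul_congr (Setoid.refl _) s.mul_symm) t.symm.mul_one)
  exact Setoid.trans (Setoid.symm s.symm.one_mul)
    (Setoid.trans (mul_congr (Setoid.symm h1) (Setoid.refl _)) h2)

/-- The value `s(a)`, as an element of `D(C)` with source `f₁ a = b` and target `a`. -/
def value (s : SectionAt 𝒞 L b a) : DSquare 𝒞 b a := s.2.2.2 ▸ s.1.sq 𝒞 a

theorem sigma_value (s : SectionAt 𝒞 L b a) :
    (⟨b, s.value⟩ : Σ d : Arr X, DSquare 𝒞 d a) = ⟨_, s.1.sq 𝒞 a⟩ := by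
  obtain ⟨s, hs, ha, rfl⟩ := s
  rfl

theorem value_congr {s t : SectionAt 𝒞 L b a} (h : s ≈ t) : s.value = t.value := by
  have h1 : (⟨b, s.value⟩ : Σ d : Arr X, DSquare 𝒞 d a) = ⟨b, t.value⟩ := by
    rw [sigma_value, sigma_value]
    exact SameGerm.sq_eq h
  obtain ⟨_, h⟩ := Sigma.mk.inj h1
  exact eq_of_heq h

end SectionAt

/-- The groupoid `J(D(C))` of germs of local linear sections, with object set the set of arrows
of `G`: the germ of `s` at `a` is an arrow from `f₁ a` to `a`, and the composite of the germs of `s`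
at `f₁ a` and of `t` at `a`, with `f₁ = α₁ t`, is the germ of `s * t` at `a`. -/
instance germGroupoid (𝒞 : CrossedModule X C) (L : LieGroupoid r X) :
    Groupoid (GermObj 𝒞 L) where
  Hom b a := Quotient (germSetoid 𝒞 L b a)
  id a := Quotient.mk _ (SectionAt.one a)
  comp p q := Quotient.map₂ SectionAt.mul (fun _ _ h _ _ h' => SectionAt.mul_congr h h') p q
  id_comp p := by
    induction p using Quotient.inductionOn with
    | h s => exact Quotient.sound s.one_mul
  comp_id p := by
    induction p using Quotient.inductionOn with
    | h s => exact Quotient.sound s.mul_one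
  assoc p q k := by
    induction p using Quotient.inductionOn with
    | h s =>
      induction q using Quotient.inductionOn with
      | h t =>
        induction k using Quotient.inductionOn with
        | h k => exact Quotient.sound (s.mul_assoc t k)
  inv p := Quotient.map SectionAt.symm (fun _ _ h => SectionAt.symm_congr h) p
  inv_comp p := by
    induction p using Quotient.inductionOn with
    | h s => exact Quotient.sound s.symm_mul
  comp_inv p := by
    induction p using Quotient.inductionOn with
    | h s => exact Quotient.sound s.mul_symm

/-- The germ `[s]_a`. -/
def germ {𝒞 : CrossedModule X C} {L : LieGroupoid r X} {b a : GermObj 𝒞 L}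
    (s : SectionAt 𝒞 L b a) : b ⟶ a := Quotient.mk _ s

/-- The final map `ψ : J(D(C)) → D(C)`, `[s]_a ↦ s(a)`. -/
def finalMap (𝒞 : CrossedModule X C) (L : LieGroupoid r X) : GermObj 𝒞 L ⥤ SqObj 𝒞 where
  obj a := a
  map p := Quotient.lift SectionAt.value (fun _ _ h => SectionAt.value_congr h) p
  map_id a := by
    change (SectionAt.one a : SectionAt 𝒞 L a a).value = DSquare.vid a
    have h : ∀ (d : Arr X) (_ : d = a) (w : DSquare 𝒞 d a), w.val = 0 →
      (⟨d.src, w.left⟩ : Σ p : X, (p ⟶ Arr.src a)) = ⟨Arr.src a, 𝟙 _⟩ →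
      (⟨d.tgt, w.right⟩ : Σ p : X, (p ⟶ Arr.tgt a)) = ⟨Arr.tgt a, 𝟙 _⟩ →
      (⟨d, w⟩ : Σ d : Arr X, DSquare 𝒞 d a) = ⟨a, DSquare.vid a⟩ := by
      rintro _ rfl w h1 h2 h3
      obtain ⟨_, h2⟩ := Sigma.mk.inj h2
      obtain ⟨_, h3⟩ := Sigma.mk.inj h3
      rw [DSquare.ext (eq_of_heq h2) (eq_of_heq h3) h1 (y := DSquare.vid _)]
    have h' := (SectionAt.sigma_value (SectionAt.one a : SectionAt 𝒞 L a a)).trans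
      (h _ (SectionData.one_F₁ 𝒞 a) (SectionData.one.sq 𝒞 a) rfl rfl rfl)
    obtain ⟨_, h'⟩ := Sigma.mk.inj h'
    exact eq_of_heq h'
  map_comp {c b a} p q := by
    induction p using Quotient.inductionOn with
    | h s =>
      induction q using Quotient.inductionOn with
      | h t =>
        change (s.mul t).value = s.value.vcomp t.value
        obtain ⟨t, ht, ha, rfl⟩ := t
        obtain ⟨s, hs, hb, rfl⟩ := s
        have h : ∀ (d : Arr X) (e : d = s.F₁ 𝒞 (t.F₁ 𝒞 a)) (w : DSquare 𝒞 d a)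
            (w' : DSquare 𝒞 (s.F₁ 𝒞 (t.F₁ 𝒞 a)) a), w.val = w'.val →
            (⟨d.src, w.left⟩ : Σ p : X, (p ⟶ Arr.src a)) = ⟨_, w'.left⟩ →
            (⟨d.tgt, w.right⟩ : Σ p : X, (p ⟶ Arr.tgt a)) = ⟨_, w'.right⟩ →
            (e ▸ w : DSquare 𝒞 (s.F₁ 𝒞 (t.F₁ 𝒞 a)) a) = w' := by
          rintro _ rfl w w' h1 h2 h3
          obtain ⟨_, h2⟩ := Sigma.mk.inj h2
          obtain ⟨_, h3⟩ := Sigma.mk.inj h3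
          exact DSquare.ext (eq_of_heq h2) (eq_of_heq h3) h1
        exact h _ _ ((s.mul t 𝒞).sq 𝒞 a) _ rfl rfl rfl

/-! ### `V`-locally Lie double groupoids -/

/-- A `C^r` structure on `G` and `X` making `(G, X)` a Lie groupoid, and a `C^r` manifold `W`
contained as a set in `C`. -/
structure LocalData (r : Smoothness) (𝒞 : CrossedModule X C) where
  L : LieGroupoid r X
  W : Set (Σ x : X, C x)
  mfdW : CrStructure r W

namespace LocalData

variable {𝒞 : CrossedModule X C} (Λ : LocalData r 𝒞)

/-- The square belongs to the set `W^G`: its element `w₁` lies in `W`. -/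
def MemWG {d a : Arr X} (w : DSquare 𝒞 d a) : Prop := (⟨a.tgt, w.val⟩ : Σ x : X, C x) ∈ Λ.W

/-- The manifold `W × G × G × G`, in which `W^G` is a submanifold. -/
def ambient : CrStructure r (Λ.W × Arr X × Arr X × Arr X) :=
  Λ.mfdW.prod (Λ.L.arr.prod (Λ.L.arr.prod Λ.L.arr))

/-- The element `(w₁, b, a, c)` of `W × G × G × G` describing a square in `W^G`. -/
def coords {d a : Arr X} (w : DSquare 𝒞 d a) (hw : Λ.MemWG w) : Λ.W × Arr X × Arr X × Arr X :=
  (⟨⟨a.tgt, w.val⟩, hw⟩, Arr.of w.left, a, Arr.of w.right)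

/-- `W^G` as a subset of `W × G × G × G`. -/
def WG : Set (Λ.W × Arr X × Arr X × Arr X) :=
  {p | ∃ (d a : Arr X) (w : DSquare 𝒞 d a) (hw : Λ.MemWG w), p = Λ.coords w hw}

/-- The set `W^G ⊓ W^G` of pairs of elements of `W^G` with the same `β₁`. -/
def pairs : Set ((Λ.W × Arr X × Arr X × Arr X) × (Λ.W × Arr X × Arr X × Arr X)) :=
  {p | ∃ (d d' a : Arr X) (w : DSquare 𝒞 d a) (w' : DSquare 𝒞 d' a) (hw : Λ.MemWG w)
    (hw' : Λ.MemWG w'), p = (Λ.coords w hw, Λ.coords w' hw')}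

/-- The difference `w -₁ w'` of two squares with the same `β₁`. -/
def diff {d d' a : Arr X} (w : DSquare 𝒞 d a) (w' : DSquare 𝒞 d' a) : DSquare 𝒞 d d' :=
  w.vcomp w'.vinv

/-- The set of those `(w, w')` in `W^G ⊓ W^G` with `w -₁ w' ∈ W^G`. -/
def diffDomain : Set ((Λ.W × Arr X × Arr X × Arr X) × (Λ.W × Arr X × Arr X × Arr X)) :=
  {p | ∃ (d d' a : Arr X) (w : DSquare 𝒞 d a) (w' : DSquare 𝒞 d' a) (hw : Λ.MemWG w)
    (hw' : Λ.MemWG w'), Λ.MemWG (diff w w') ∧ p = (Λ.coords w hw, Λ.coords w' hw')}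

/-- `Γ^r(W^G)`: local linear sections with values in `W^G` which are smooth, i.e. `s₀` and `s₁`
are smooth as maps `U₀ → G` and `U₁ → W`. -/
def IsSmoothSection (s : SectionData X C) : Prop :=
  IsLocalLinear 𝒞 Λ.L s ∧ (∀ a ∈ s.U₁, Λ.MemWG (s.sq 𝒞 a)) ∧
    Λ.L.obj.SmoothOn Λ.L.arr (fun x => Arr.of (s.e x)) s.U₀ ∧
    ∃ σ : Arr X → Λ.W, Λ.L.arr.SmoothOn Λ.mfdW σ s.U₁ ∧
      ∀ a ∈ s.U₁, (σ a : Σ x : X, C x) = ⟨a.tgt, s.s₁ a.hom⟩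

/-- The section `s` passes through `w`: `s (β₁ w) = w`. -/
def Through (s : SectionData X C) {d a : Arr X} (w : DSquare 𝒞 d a) : Prop :=
  a ∈ s.U₁ ∧ (⟨_, s.sq 𝒞 a⟩ : Σ d : Arr X, DSquare 𝒞 d a) = ⟨d, w⟩

/-- Enough smooth local linear coadmissible sections. Only those `w ∈ W^G` are considered which lie
on some local linear coadmissible section, not necessarily smooth or with values in `W^G`:
there is none through a general square (for instance `s₁ (1_x) = 0` for each section `s`). -/
def EnoughSections : Prop :=
  ∀ (d a : Arr X) (w : DSquare 𝒞 d a), Λ.MemWG w →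
    (∃ s : SectionData X C, IsLocalLinear 𝒞 Λ.L s ∧ Through s w) →
    ∃ s : SectionData X C, Λ.IsSmoothSection s ∧ Through s w

end LocalData

/-- A `V`-locally Lie double groupoid structure `(D(C), W^G)` on `D(C)`. -/
structure VLocallyLie (r : Smoothness) (𝒞 : CrossedModule X C) extends LocalData r 𝒞 where
  /-- `β : W → X` is a smooth surmersion. -/
  submersion_W : mfdW.IsSubmersion L.obj (fun w : W => w.1.1)
  surjective_W : Function.Surjective (fun w : W => w.1.1)
  /-- `W^G = -₁ W^G` -/
  inv_mem : ∀ (d a : SqObj 𝒞) (w : d ⟶ a),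
    toLocalData.MemWG w ↔ toLocalData.MemWG (Groupoid.inv w)
  /-- `G ⊆ W^G` -/
  one_mem : ∀ a : SqObj 𝒞, toLocalData.MemWG (𝟙 a)
  /-- the domain is open in `W^G ⊓ W^G` -/
  diff_open : ∃ O, (toLocalData.ambient.prod toLocalData.ambient).IsOpen O ∧
    toLocalData.diffDomain = toLocalData.pairs ∩ O
  /-- the difference map is smooth on its domain -/
  diff_smooth : ∃ D, (toLocalData.ambient.prod toLocalData.ambient).SmoothOn toLocalData.ambient D
      toLocalData.diffDomain ∧
    ∀ (d d' a : Arr X) (w : DSquare 𝒞 d a) (w' : DSquare 𝒞 d' a) (hw : toLocalData.MemWG w)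
      (hw' : toLocalData.MemWG w') (h : toLocalData.MemWG (LocalData.diff w w')),
      D (toLocalData.coords w hw, toLocalData.coords w' hw') =
        toLocalData.coords (LocalData.diff w w') h
  /-- the source and target maps are smooth on `W^G` -/
  source_smooth : ∃ A, toLocalData.ambient.SmoothOn L.arr A toLocalData.WG ∧
    ∀ (d a : Arr X) (w : DSquare 𝒞 d a) (hw : toLocalData.MemWG w), A (toLocalData.coords w hw) = d
  target_smooth : ∃ B, toLocalData.ambient.SmoothOn L.arr B toLocalData.WG ∧
    ∀ (d a : Arr X) (w : DSquare 𝒞 d a) (hw : toLocalData.MemWG w), B (toLocalData.coords w hw) = a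
  /-- `W^G` has enough smooth local linear coadmissible sections. -/
  enough : toLocalData.EnoughSections
  /-- `W^G` generates `D(C)` with respect to `+₁`. -/
  generates : Subgroupoid.generated
    (fun (d a : SqObj 𝒞) => {w : d ⟶ a | toLocalData.MemWG w}) = ⊤

namespace LocalData

variable {𝒞 : CrossedModule X C} (Λ : LocalData r 𝒞)

/-- `Γ^r(D(C), W^G)`: the sections generated by `Γ^r(W^G)` under products and inverses. -/
inductive IsIterate : SectionData X C → Prop
  | of (s : SectionData X C) (hs : Λ.IsSmoothSection s) : IsIterate s
  | mul (s t : SectionData X C) (hs : IsIterate s) (ht : IsIterate t) : IsIterate (s.mul t 𝒞)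
  | symm (s : SectionData X C) (hs : IsIterate s) : IsIterate (s.symm 𝒞)

/-- `J^r(W^G)`: the germs of the elements of `Γ^r(W^G)`. -/
def JrW (b a : GermObj 𝒞 Λ.L) : Set (b ⟶ a) :=
  {p | ∃ s : SectionAt 𝒞 Λ.L b a, Λ.IsSmoothSection s.1 ∧ germ s = p}

/-- `J^r(D(C))`: the subgroupoid of `J(D(C))` of the germs of the elements of
`Γ^r(D(C), W^G)`. -/
def Jr : Subgroupoid (GermObj 𝒞 Λ.L) where
  arrows b a := {p | ∃ s : SectionAt 𝒞 Λ.L b a, Λ.IsIterate s.1 ∧ germ s = p}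
  inv := by
    rintro b a _ ⟨s, hs, rfl⟩
    exact ⟨s.symm, IsIterate.symm _ hs, rfl⟩
  mul := by
    rintro c b a _ ⟨s, hs, rfl⟩ _ ⟨t, ht, rfl⟩
    exact ⟨s.mul t, IsIterate.mul _ _ hs ht, rfl⟩

/-- `J₀ = J^r(W^G) ∩ Ker ψ`, a set of germs. -/
def J₀ (b a : GermObj 𝒞 Λ.L) : Set (b ⟶ a) :=
  Λ.JrW b a ∩ (Subgroupoid.ker (finalMap 𝒞 Λ.L)).arrows b a

/-- Parallel arrows `p`, `q` of `J^r(D(C))` lie in the same coset of `J₀`. -/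
def holRel : HomRel Λ.Jr.objs :=
  fun b _ p q => (p ≫ inv q).val ∈ Λ.J₀ b.val b.val

/-- The holonomy groupoid `Hol(D(C), W^G) = J^r(D(C)) / J₀`, with the objects of `J^r(D(C))`. -/
abbrev Hol : Type (max u v) := CategoryTheory.Quotient Λ.holRel

/-- The quotient morphism `J^r(D(C)) → Hol(D(C), W^G)`. -/
def toHol : Λ.Jr.objs ⥤ Λ.Hol := Quotient.functor Λ.holRel

end LocalData

end

end

end

/-! Everything rests on one fact about $J^r(W^G)$, which need not be closed under composition. If
$p=[s]_a$ and $q=[t]_a$ come from $\Gamma^r(W^G)$ and $\psi(p*q^{-1})=s(a)-_1t(a)$ lies in $W^G$,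
then $p*q^{-1}\in J^r(W^G)$ (`VLocallyLie.comp_inv_mem_JrW`). Indeed $s*t^{-1}$ takes the value
$s(b)-_1t(b)$ at $f_1(b)$, where $f_1=\alpha_1t$. The difference map of $W^G$ has an open domain and
is smooth there, so these values stay in $W^G$ and vary smoothly near $f_1(a)$; the vertical edges
vary smoothly because $G$ is a Lie groupoid (`VLocallyLie.exists_isSmoothSection_mul_symm`).

The rest is algebra. On $\operatorname{Ker}\psi$ the condition on $\psi(p*q^{-1})$ is automatic,
since identities lie in $W^G$; so $J_0$ is closed under differences that lie in the kernel. Enough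
sections give a smooth section through $1_a$, and its germ minus itself is the identity germ; $1-q$
then gives inverses. For $p\in J^r(W^G)$ and $k\in J_0$ the germ $p*k^{-1}$ has the value
$\psi(p)\in W^G$, hence lies in $J^r(W^G)$, and $p*k*p^{-1}=p*(p*k^{-1})^{-1}$ is a difference with
identity value, hence in $J_0$. The germs normalizing $J_0$ form a subgroupoid, so all of
$J^r(\mathcal D(\mathcal C))$, which $J^r(W^G)$ generates (`LocalData.Jr_le`), normalizes $J_0$.
Cosets of a normal subgroupoid form a congruence. -/

section

/-! ### Calculus of $C^r$ maps and partial diffeomorphisms. -/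

namespace CrStructure

variable {r : Smoothness} {M : Type u} {N : Type v} {P : Type w}

theorem SmoothOn.prodMk {A : CrStructure r M} {B : CrStructure r N} {D : CrStructure r P}
    {f : M → N} {g : M → P} {S : Set M} (hf : A.SmoothOn B f S) (hg : A.SmoothOn D g S) :
    A.SmoothOn (B.prod D) (fun x => (f x, g x)) S := by
  cases r with
  | negOne =>
    let := A.top; let := B.top; let := D.top
    exact ContinuousOn.prodMk (f := f) (g := g) hf hg
  | cr n =>
    obtain ⟨tM, a⟩ := A
    obtain ⟨tN, b⟩ := B
    obtain ⟨tP, d⟩ := D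
    let := tM; let := tN; let := tP
    let a' : ManifoldAtlas n M := a
    let b' : ManifoldAtlas n N := b
    let d' : ManifoldAtlas n P := d
    let := a'.charted; let := b'.charted; let := d'.charted
    exact ContMDiffOn.prodMk (I := a'.I) (I' := b'.I) (J' := d'.I) (n := n) (f := f) (g := g) hf hg

theorem smoothOn_fst (A : CrStructure r M) (B : CrStructure r N) (S : Set (M × N)) :
    (A.prod B).SmoothOn A Prod.fst S := by
  cases r with
  | negOne =>
    let := A.top; let := B.top
    exact continuousOn_fst
  | cr n =>
    obtain ⟨tM, a⟩ := A
    obtain ⟨tN, b⟩ := B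
    let := tM; let := tN
    let a' : ManifoldAtlas n M := a
    let b' : ManifoldAtlas n N := b
    let := a'.charted; let := b'.charted
    exact contMDiffOn_fst (I := a'.I) (J := b'.I) (n := n)

theorem IsSubmersion.smoothOn {A : CrStructure r M} {B : CrStructure r N} {f : M → N}
    (h : A.IsSubmersion B f) (S : Set M) : A.SmoothOn B f S := by
  cases r with
  | negOne =>
    let := A.top; let := B.top
    exact h.1.continuousOn
  | cr n =>
    obtain ⟨tM, a⟩ := A
    obtain ⟨tN, b⟩ := B
    let := tM; let := tN
    let a' : ManifoldAtlas n M := a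
    let b' : ManifoldAtlas n N := b
    let := a'.charted; let := b'.charted
    intro x _
    exact ContMDiffAt.contMDiffWithinAt (I := a'.I) (I' := b'.I) (n := n)
      (Manifold.IsSubmersionAt.contMDiffAt (I := a'.I) (J := b'.I) (n := n) (h x))

theorem IsPartialDiffeo.mono {A : CrStructure r M} {f : M → M} {U V : Set M}
    (h : A.IsPartialDiffeo f U) (hV : A.IsOpen V) (hVU : V ⊆ U) : A.IsPartialDiffeo f V := by
  obtain ⟨g, hg, hgs⟩ := h.smooth_inv
  -- Inside the open range of $f$, the image of $V$ is a preimage under the smooth inverse; this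
  -- makes it open.
  have himg : f '' V = f '' U ∩ g ⁻¹' V := by
    ext y
    constructor
    · rintro ⟨x, hx, rfl⟩
      exact ⟨⟨x, hVU hx, rfl⟩, by rwa [Set.mem_preimage, hg (hVU hx)]⟩
    · rintro ⟨⟨x, hx, rfl⟩, hx'⟩
      rw [Set.mem_preimage, hg hx] at hx'
      exact ⟨x, hx', rfl⟩
  exact
    { open_domain := hV
      open_range := himg ▸ isOpen_inter_preimage hgs h.open_range hV
      injOn := h.injOn.mono hVU
      smooth := h.smooth.mono hVU
      smooth_inv := ⟨g, hg.mono hVU, hgs.mono (Set.image_mono hVU)⟩ }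

end CrStructure

/-! ### Restriction of local linear sections, and the values of $s*t^{-1}$. -/

variable {X : Type u} [Groupoid.{v} X] {C : X → Type w} [∀ x, AddGroup (C x)]
  {r : Smoothness} {𝒞 : CrossedModule X C}

/-- The section `s` with the domain of `s₁` restricted to `V`. -/
def SectionData.restrict (s : SectionData X C) (V : Set (Arr X)) : SectionData X C where
  U₀ := s.U₀
  U₁ := V
  s₀ := s.s₀
  s₁ := s.s₁

/-- Functoriality of $\psi$. The form with `Groupoid.inv` unfolds to `symm` of sections and $-_1$ of
squares, so that it can be read directly as an equation between values of sections. -/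
theorem finalMap_map_comp_inv {L : LieGroupoid r X} {b c a : GermObj 𝒞 L} (p : b ⟶ a)
    (q : c ⟶ a) : (finalMap 𝒞 L).map (p ≫ Groupoid.inv q) =
      (finalMap 𝒞 L).map p ≫ Groupoid.inv ((finalMap 𝒞 L).map q) := by
  rw [Functor.map_comp, Groupoid.inv_eq_inv, Functor.map_inv, Groupoid.inv_eq_inv]

namespace IsLocalLinear

variable {L : LieGroupoid r X} {s t : SectionData X C}

theorem restrict (hs : IsLocalLinear 𝒞 L s) {V : Set (Arr X)} (hV : L.arr.IsOpen V)
    (h : V ⊆ s.U₁) : IsLocalLinear 𝒞 L (s.restrict V) where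
  src_mem a ha := hs.src_mem a (h ha)
  tgt_mem a ha := hs.tgt_mem a (h ha)
  linear x y z a b ha hb hab := hs.linear x y z a b (h ha) (h hb) (h hab)
  diffeo₀ := hs.diffeo₀
  diffeo₁ := hs.diffeo₁.mono hV h
  linear_F₁ a ha b hb c hc := hs.linear_F₁ a (h ha) b (h hb) c (h hc)
  linear_F₁_inv a ha b hb c hc := hs.linear_F₁_inv a (h ha) b (h hb) c (h hc)

/-- The sources of the two arrows are only propositionally equal, hence an equality in `Arr X`; the
dependent pair of source and arrow has to be replaced as a whole. -/
theorem mul_symm_e (ht : IsLocalLinear 𝒞 L t) (s : SectionData X C) {x : X} (hx : x ∈ t.U₀) :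
    Arr.of ((s.mul (t.symm 𝒞) 𝒞).e (t.f₀ x)) = Arr.of (s.e x ≫ inv (t.e x)) := by
  have key : ∀ p : Σ p : X, (p ⟶ t.f₀ x), p = ⟨x, inv (t.e x)⟩ →
      Arr.of (s.e p.1 ≫ p.2) = Arr.of (s.e x ≫ inv (t.e x)) := by
    rintro _ rfl
    rfl
  exact key _ (SectionData.symm_s₀ ht.diffeo₀.injOn hx)

/-- The value of `s * t⁻¹` at `f₁ a`, where `f₁ = α₁ t`, is `s a -₁ t a`. -/
theorem mul_symm_sq (hs : IsLocalLinear 𝒞 L s) (ht : IsLocalLinear 𝒞 L t) {a : Arr X}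
    (has : a ∈ s.U₁) (hat : a ∈ t.U₁) :
    (⟨_, (s.mul (t.symm 𝒞) 𝒞).sq 𝒞 (t.F₁ 𝒞 a)⟩ : Σ d : Arr X, DSquare 𝒞 d (t.F₁ 𝒞 a)) =
      ⟨s.F₁ 𝒞 a, LocalData.diff (s.sq 𝒞 a) (t.sq 𝒞 a)⟩ := by
  let S : SectionAt 𝒞 L (s.F₁ 𝒞 a) a := ⟨s, hs, has, rfl⟩
  let T : SectionAt 𝒞 L (t.F₁ 𝒞 a) a := ⟨t, ht, hat, rfl⟩
  -- No computation with squares is needed: both sides unfold from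
  -- $\psi(p*q^{-1})=\psi(p)-_1\psi(q)$.
  have h : (S.mul T.symm).value = LocalData.diff (s.sq 𝒞 a) (t.sq 𝒞 a) :=
    finalMap_map_comp_inv (germ S) (germ T)
  rw [← h]
  exact (SectionAt.sigma_value (S.mul T.symm)).symm

end IsLocalLinear

/-! ### Coordinates on $W^G$ inside $W\times G\times G\times G$. -/

namespace LocalData

/-- The coordinates omit the top edge, but the boundary condition recovers it as
$d=b+a+\delta(w_1)-c$. -/
theorem sigma_eq_of_coords_eq (Λ : LocalData r 𝒞) {d a d' a' : Arr X} {w : DSquare 𝒞 d a}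
    {w' : DSquare 𝒞 d' a'} {hw : Λ.MemWG w} {hw' : Λ.MemWG w'}
    (h : Λ.coords w hw = Λ.coords w' hw') :
    (⟨d, a, w⟩ : Σ d a : Arr X, DSquare 𝒞 d a) = ⟨d', a', w'⟩ := by
  obtain ⟨h1, h⟩ := Prod.mk.inj h
  obtain ⟨h2, h⟩ := Prod.mk.inj h
  obtain ⟨rfl, h3⟩ := Prod.mk.inj h
  obtain ⟨-, h1⟩ := Sigma.mk.inj (Subtype.mk.inj h1)
  obtain ⟨x, y, k⟩ := d
  obtain ⟨x', y', k'⟩ := d'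
  obtain ⟨l, m, c, hc⟩ := w
  obtain ⟨l', m', c', hc'⟩ := w'
  obtain ⟨rfl, h2⟩ := Arr.mk.inj h2
  obtain ⟨rfl, h3⟩ := Arr.mk.inj h3
  obtain rfl : l = l' := eq_of_heq h2.2
  obtain rfl : m = m' := eq_of_heq h3.2
  obtain rfl : c = c' := eq_of_heq h1
  obtain rfl : k = k' := by
    rw [hc] at hc'
    exact (cancel_mono m).1 (by simpa using hc')
  rfl

/-- `diffDomain` only provides some squares with the given coordinates; injectivity of the
coordinates identifies them with $w$ and $w'$. -/
theorem memWG_diff_of_mem_diffDomain (Λ : LocalData r 𝒞) {d d' a : Arr X} {w : DSquare 𝒞 d a}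
    {w' : DSquare 𝒞 d' a} {hw : Λ.MemWG w} {hw' : Λ.MemWG w'}
    (h : (Λ.coords w hw, Λ.coords w' hw') ∈ Λ.diffDomain) : Λ.MemWG (diff w w') := by
  obtain ⟨e, e', b, v, v', hv, hv', hd, h⟩ := h
  obtain ⟨h1, h2⟩ := Prod.mk.inj h
  have h1 := Λ.sigma_eq_of_coords_eq h1
  have h2 := Λ.sigma_eq_of_coords_eq h2
  obtain ⟨rfl, h1⟩ := Sigma.mk.inj h1
  obtain ⟨rfl, h1⟩ := Sigma.mk.inj (eq_of_heq h1)
  obtain rfl := eq_of_heq h1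
  obtain ⟨rfl, h2⟩ := Sigma.mk.inj h2
  obtain ⟨-, h2⟩ := Sigma.mk.inj (eq_of_heq h2)
  obtain rfl := eq_of_heq h2
  exact hd

/-- The coordinates in `W × G × G × G` of the values of a section `s`, where `σ` is `s₁` as a map
to `W`. -/
def sectionCoords (Λ : LocalData r 𝒞) (s : SectionData X C) (σ : Arr X → Λ.W) (a : Arr X) :
    Λ.W × Arr X × Arr X × Arr X :=
  (σ a, Arr.of (s.e a.src), a, Arr.of (s.e a.tgt))

theorem sectionCoords_eq (Λ : LocalData r 𝒞) {s : SectionData X C} {σ : Arr X → Λ.W} {a : Arr X}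
    (h : (σ a : Σ x : X, C x) = ⟨a.tgt, s.s₁ a.hom⟩) (hw : Λ.MemWG (s.sq 𝒞 a)) :
    Λ.sectionCoords s σ a = Λ.coords (s.sq 𝒞 a) hw :=
  Prod.ext (Subtype.ext h) rfl

theorem smoothOn_sectionCoords (Λ : LocalData r 𝒞) {s : SectionData X C} {σ : Arr X → Λ.W}
    (hs : IsLocalLinear 𝒞 Λ.L s)
    (h₀ : Λ.L.obj.SmoothOn Λ.L.arr (fun x => Arr.of (s.e x)) s.U₀)
    (hσ : Λ.L.arr.SmoothOn Λ.mfdW σ s.U₁) :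
    Λ.L.arr.SmoothOn Λ.ambient (Λ.sectionCoords s σ) s.U₁ :=
  hσ.prodMk ((h₀.comp (Λ.L.src_submersion.smoothOn _) hs.src_mem).prodMk
    ((CrStructure.smoothOn_id _ _).prodMk
      (h₀.comp (Λ.L.tgt_submersion.smoothOn _) hs.tgt_mem)))

end LocalData

/-! ### Smoothness of $s*t^{-1}$ near a point. -/

namespace VLocallyLie

variable (Λ : VLocallyLie r 𝒞)

/-- If `s, t ∈ Γ^r(W^G)` and `s a -₁ t a ∈ W^G`, then `s * t⁻¹`, restricted to a neighbourhood of
`f₁ a` where `f₁ = α₁ t`, belongs to `Γ^r(W^G)`. -/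
theorem exists_isSmoothSection_mul_symm {s t : SectionData X C} (hs : Λ.IsSmoothSection s)
    (ht : Λ.IsSmoothSection t) {a : Arr X} (has : a ∈ s.U₁) (hat : a ∈ t.U₁)
    (hd : Λ.MemWG (LocalData.diff (s.sq 𝒞 a) (t.sq 𝒞 a))) :
    ∃ V : Set (Arr X), Λ.L.arr.IsOpen V ∧ t.F₁ 𝒞 a ∈ V ∧ V ⊆ (s.mul (t.symm 𝒞) 𝒞).U₁ ∧
      Λ.IsSmoothSection ((s.mul (t.symm 𝒞) 𝒞).restrict V) := by
  obtain ⟨hsl, hsW, hs₀, σ, hσ, hσe⟩ := hs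
  obtain ⟨htl, htW, ht₀, τ, hτ, hτe⟩ := ht
  obtain ⟨O, hO, hOe⟩ := Λ.diff_open
  obtain ⟨D, hD, hDe⟩ := Λ.diff_smooth
  obtain ⟨E, hE, hEe⟩ := Λ.L.diff_smooth
  have hul := hsl.mul htl.symm
  -- At $k=f_1(b)$ this is the pair $(s(b),t(b))$. It is a total function, so its smoothness can be
  -- stated without proofs of membership in $W^G$.
  let Φ : Arr X → (Λ.W × Arr X × Arr X × Arr X) × (Λ.W × Arr X × Arr X × Arr X) := fun k =>
    (Λ.sectionCoords s σ ((t.symm 𝒞).F₁ 𝒞 k), Λ.sectionCoords t τ ((t.symm 𝒞).F₁ 𝒞 k))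
  have hg : Λ.L.arr.SmoothOn Λ.L.arr ((t.symm 𝒞).F₁ 𝒞) (s.mul (t.symm 𝒞) 𝒞).U₁ :=
    htl.symm.diffeo₁.smooth.mono Set.inter_subset_left
  have hΦ : Λ.L.arr.SmoothOn (Λ.ambient.prod Λ.ambient) Φ (s.mul (t.symm 𝒞) 𝒞).U₁ := by
    refine ((Λ.smoothOn_sectionCoords hsl hs₀ hσ).comp hg fun k hk => hk.2).prodMk
      ((Λ.smoothOn_sectionCoords htl ht₀ hτ).comp hg ?_)
    rintro _ ⟨⟨b, hb, rfl⟩, -⟩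
    rwa [htl.symm_F₁ hb]
  have hΦe : ∀ b (hb : b ∈ s.U₁) (hb' : b ∈ t.U₁), Φ (t.F₁ 𝒞 b) =
      (Λ.coords (s.sq 𝒞 b) (hsW b hb), Λ.coords (t.sq 𝒞 b) (htW b hb')) := by
    intro b hb hb'
    simp only [Φ, htl.symm_F₁ hb']
    rw [Λ.sectionCoords_eq (hσe b hb) (hsW b hb), Λ.sectionCoords_eq (hτe b hb') (htW b hb')]
  -- The two values share the bottom edge $b$, so they always form an element of `pairs`; membership
  -- in $O$ is then all that `diffDomain` requires.
  have hmem : ∀ k ∈ (s.mul (t.symm 𝒞) 𝒞).U₁ ∩ Φ ⁻¹' O, ∃ b, ∃ (hb : b ∈ s.U₁) (hb' : b ∈ t.U₁)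
      (_ : Λ.MemWG (LocalData.diff (s.sq 𝒞 b) (t.sq 𝒞 b))), k = t.F₁ 𝒞 b ∧
        (Λ.coords (s.sq 𝒞 b) (hsW b hb), Λ.coords (t.sq 𝒞 b) (htW b hb')) ∈ Λ.diffDomain := by
    rintro _ ⟨⟨⟨b, hb', rfl⟩, hb⟩, hbO⟩
    rw [Set.mem_preimage, htl.symm_F₁ hb'] at hb
    rw [Set.mem_preimage, hΦe b hb hb'] at hbO
    have h : (Λ.coords (s.sq 𝒞 b) (hsW b hb), Λ.coords (t.sq 𝒞 b) (htW b hb')) ∈ Λ.diffDomain := by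
      rw [hOe]
      exact ⟨⟨_, _, _, _, _, _, _, rfl⟩, hbO⟩
    exact ⟨b, hb, hb', Λ.memWG_diff_of_mem_diffDomain h, rfl, h⟩
  have hVo : Λ.L.arr.IsOpen ((s.mul (t.symm 𝒞) 𝒞).U₁ ∩ Φ ⁻¹' O) :=
    CrStructure.isOpen_inter_preimage hΦ hul.diffeo₁.open_domain hO
  -- The neighbourhood is $U_1\cap\Phi^{-1}(O)$, and $s_1$ of the product, as a map to $W$, is the
  -- first coordinate of $D\circ\Phi$.
  refine ⟨_, hVo, ⟨⟨⟨a, hat, rfl⟩, ?_⟩, ?_⟩, Set.inter_subset_left,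
    hul.restrict hVo Set.inter_subset_left, ?_, ?_, fun k => (D (Φ k)).1, ?_, ?_⟩
  · rwa [Set.mem_preimage, htl.symm_F₁ hat]
  · rw [Set.mem_preimage, hΦe a has hat]
    have h : (Λ.coords (s.sq 𝒞 a) (hsW a has), Λ.coords (t.sq 𝒞 a) (htW a hat)) ∈
        Λ.diffDomain := ⟨_, _, _, _, _, _, _, hd, rfl⟩
    rw [hOe] at h
    exact h.2
  · intro k hk
    obtain ⟨b, hb, hb', hbd, rfl, -⟩ := hmem k hk
    have h := congrArg (fun p : Σ d : Arr X, DSquare 𝒞 d (t.F₁ 𝒞 b) => Λ.MemWG p.2)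
      (hsl.mul_symm_sq htl hb hb')
    exact h.mpr hbd
  -- The component over $X$ does not involve $W$: at $f_0(x)$ it is $s_0(x)-t_0(x)$, smooth by the
  -- difference map of the Lie groupoid. Hence $U_0$ need not shrink.
  · have hg₀ : Λ.L.obj.SmoothOn Λ.L.obj (t.symm 𝒞).f₀ (s.mul (t.symm 𝒞) 𝒞).U₀ :=
      htl.symm.diffeo₀.smooth.mono Set.inter_subset_left
    have h₁ := hs₀.comp hg₀ fun z hz => hz.2
    have h₂ := ht₀.comp hg₀ (by
      rintro _ ⟨⟨x, hx, rfl⟩, -⟩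
      rwa [htl.symm_f₀ hx])
    refine (hE.comp (h₁.prodMk h₂) fun _ _ => rfl).congr ?_
    rintro _ ⟨⟨x, hx, rfl⟩, -⟩
    change Arr.of ((s.mul (t.symm 𝒞) 𝒞).e (t.f₀ x)) =
      E (Arr.of (s.e ((t.symm 𝒞).f₀ (t.f₀ x))), Arr.of (t.e ((t.symm 𝒞).f₀ (t.f₀ x))))
    rw [htl.symm_f₀ hx, hEe, htl.mul_symm_e s hx]
  · refine (CrStructure.smoothOn_fst _ _ Set.univ).comp
      (hD.comp (hΦ.mono Set.inter_subset_left) ?_) fun _ _ => trivial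
    intro k hk
    obtain ⟨b, hb, hb', -, rfl, h⟩ := hmem k hk
    rwa [hΦe b hb hb']
  · intro k hk
    obtain ⟨b, hb, hb', hbd, rfl, -⟩ := hmem k hk
    change ((D (Φ (t.F₁ 𝒞 b))).1 : Σ x : X, C x) = _
    rw [hΦe b hb hb', hDe _ _ _ _ _ _ _ hbd]
    exact congrArg (fun p : Σ d : Arr X, DSquare 𝒞 d (t.F₁ 𝒞 b) =>
      (⟨_, p.2.val⟩ : Σ x : X, C x)) (hsl.mul_symm_sq htl hb hb').symm

end VLocallyLie

/-! ### Generation of $J^r(\mathcal D(\mathcal C))$ by $J^r(W^G)$. -/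

namespace LocalData

variable (Λ : LocalData r 𝒞)

theorem IsIterate.isLocalLinear {Λ : LocalData r 𝒞} {s : SectionData X C} (hs : Λ.IsIterate s) :
    IsLocalLinear 𝒞 Λ.L s := by
  induction hs with
  | of s hs => exact hs.1
  | mul s t _ _ hs ht => exact hs.mul ht
  | symm s _ hs => exact hs.symm

/-- `J^r(D(C))` is the smallest subgroupoid which contains `J^r(W^G)`. -/
theorem Jr_le (S : Subgroupoid (GermObj 𝒞 Λ.L)) (h : ∀ b a, Λ.JrW b a ⊆ S.arrows b a) :
    Λ.Jr ≤ S := by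
  -- The base point must vary in the induction: the germ of $s*t$ at $a$ involves $s$ at $f_1(a)$,
  -- where $f_1=\alpha_1t$.
  have key : ∀ s : SectionData X C, Λ.IsIterate s → ∀ (b a : GermObj 𝒞 Λ.L)
      (hs : IsLocalLinear 𝒞 Λ.L s) (ha : a ∈ s.U₁) (hb : s.F₁ 𝒞 a = b),
      germ (b := b) (a := a) ⟨s, hs, ha, hb⟩ ∈ S.arrows b a := by
    intro s hs
    induction hs with
    | of s hs => exact fun b a _ _ _ => h b a ⟨_, hs, rfl⟩
    | mul s t hs ht ihs iht =>
      intro b a _ ha hb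
      exact S.mul (ihs b (t.F₁ 𝒞 a) hs.isLocalLinear ha.2 ((s.mul_F₁ t 𝒞 a).symm.trans hb))
        (iht (t.F₁ 𝒞 a) a ht.isLocalLinear ha.1 rfl)
    | symm s hs ih =>
      -- The domain of $s^{-1}$ is the image of $f_1$, so the base point is some $f_1(a)$ and the
      -- germ there is the inverse of $[s]_a$.
      rintro b _ _ ⟨a, ha, rfl⟩ hb
      obtain rfl : a = b := (hs.isLocalLinear.symm_F₁ ha).symm.trans hb
      exact S.inv (ih (s.F₁ 𝒞 a) a hs.isLocalLinear ha rfl)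
  rw [Subgroupoid.le_iff]
  rintro b a _ ⟨s, hs, rfl⟩
  exact key s.1 hs b a s.2.1 s.2.2.1 s.2.2.2

theorem JrW_subset_Jr (b a : GermObj 𝒞 Λ.L) : Λ.JrW b a ⊆ Λ.Jr.arrows b a := by
  rintro _ ⟨s, hs, rfl⟩
  exact ⟨s, .of _ hs, rfl⟩

theorem memWG_of_mem_JrW {b a : GermObj 𝒞 Λ.L} {p : b ⟶ a} (hp : p ∈ Λ.JrW b a) :
    Λ.MemWG (d := b) (a := a) ((finalMap 𝒞 Λ.L).map p) := by
  obtain ⟨⟨s, hsl, ha, rfl⟩, hs, rfl⟩ := hp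
  exact hs.2.1 a ha

end LocalData

/-! ### Subgroupoid and normality properties of $J_0$. -/

namespace VLocallyLie

variable (Λ : VLocallyLie r 𝒞)

/-- The germ form of the key fact. It holds because shrinking the domain of $s_1$ to an open
neighbourhood leaves the germ unchanged; from here on smoothness enters only through this lemma and
`enough`. -/
theorem comp_inv_mem_JrW {b c a : GermObj 𝒞 Λ.L} {p : b ⟶ a} {q : c ⟶ a} (hp : p ∈ Λ.JrW b a)
    (hq : q ∈ Λ.JrW c a)
    (h : Λ.MemWG (d := b) (a := c) ((finalMap 𝒞 Λ.L).map (p ≫ Groupoid.inv q))) :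
    p ≫ Groupoid.inv q ∈ Λ.JrW b c := by
  rw [finalMap_map_comp_inv] at h
  obtain ⟨⟨s, hsl, has, rfl⟩, hs, rfl⟩ := hp
  obtain ⟨⟨t, htl, hat, rfl⟩, ht, rfl⟩ := hq
  obtain ⟨V, hV, haV, hVU, hu⟩ := Λ.exists_isSmoothSection_mul_symm hs ht has hat h
  let S : SectionAt 𝒞 Λ.L (s.F₁ 𝒞 a) a := ⟨s, hsl, has, rfl⟩
  let T : SectionAt 𝒞 Λ.L (t.F₁ 𝒞 a) a := ⟨t, htl, hat, rfl⟩
  refine ⟨⟨(s.mul (t.symm 𝒞) 𝒞).restrict V, hu.1, haV, (S.mul T.symm).2.2.2⟩, hu, ?_⟩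
  exact Quotient.sound (SameGerm.of_eqOn hu.1 haV subset_rfl hVU (fun _ _ => rfl)
    fun _ _ _ _ => rfl)

/-- Makes the condition on $\psi$ in `comp_inv_mem_JrW` automatic for germs in the kernel. -/
theorem memWG_of_mem_ker {b a : GermObj 𝒞 Λ.L} {p : b ⟶ a}
    (hp : p ∈ (Subgroupoid.ker (finalMap 𝒞 Λ.L)).arrows b a) :
    Λ.MemWG (d := b) (a := a) ((finalMap 𝒞 Λ.L).map p) := by
  obtain ⟨h, hp⟩ := (Subgroupoid.mem_ker_iff _ p).1 hp
  obtain rfl : b = a := h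
  rw [hp]
  exact Λ.one_mem b

theorem map_eq_id_of_mem_J₀ {a : GermObj 𝒞 Λ.L} {k : a ⟶ a} (hk : k ∈ Λ.J₀ a a) :
    (finalMap 𝒞 Λ.L).map k = 𝟙 _ := by
  obtain ⟨h, hk⟩ := (Subgroupoid.mem_ker_iff _ k).1 hk.2
  exact hk

theorem id_mem_JrW (a : GermObj 𝒞 Λ.L) : 𝟙 a ∈ Λ.JrW a a := by
  -- The constant section is only a witness for the hypothesis of `enough`; whether it is smooth as
  -- a map to $W$ plays no role.
  have h1 : LocalData.Through (𝒞 := 𝒞) (SectionData.one : SectionData X C)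
      (DSquare.vid (𝒞 := 𝒞) a) :=
    ⟨trivial, (SectionAt.sigma_value (SectionAt.one a : SectionAt 𝒞 Λ.L a a)).symm.trans
      (congrArg (Sigma.mk (β := fun d : Arr X => DSquare 𝒞 d a) a)
        ((finalMap 𝒞 Λ.L).map_id a))⟩
  obtain ⟨s, hs, ha, he⟩ := Λ.enough a a (DSquare.vid a) (Λ.one_mem a) ⟨_, .one, h1⟩
  -- This smooth germ need not be the identity germ, but its difference with itself is.
  have hp : germ ⟨s, hs.1, ha, (Sigma.mk.inj he).1⟩ ∈ Λ.JrW a a := ⟨_, hs, rfl⟩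
  have h := Λ.comp_inv_mem_JrW hp hp
  rw [Groupoid.comp_inv] at h
  exact h (Λ.memWG_of_mem_ker ((Subgroupoid.ker_isNormal _).wide a))

/-- The inverse is the difference of the identity germ and $p$, with value in $-_1W^G=W^G$. -/
theorem inv_mem_JrW {b a : GermObj 𝒞 Λ.L} {p : b ⟶ a} (hp : p ∈ Λ.JrW b a) :
    Groupoid.inv p ∈ Λ.JrW a b := by
  have h := Λ.comp_inv_mem_JrW (Λ.id_mem_JrW a) hp
  rw [Category.id_comp] at h
  refine h ?_
  have h' := (Λ.inv_mem _ _ _).1 (Λ.memWG_of_mem_JrW hp)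
  rw [Groupoid.inv_eq_inv, Functor.map_inv, ← Groupoid.inv_eq_inv]
  exact h'

/-- `J₀` as a subgroupoid of `J(D(C))`. -/
def J₀Subgroupoid : Subgroupoid (GermObj 𝒞 Λ.L) where
  arrows := Λ.J₀
  inv hp := ⟨Λ.inv_mem_JrW hp.1, Subgroupoid.inv _ hp.2⟩
  mul {_ _ _ p} hp q hq := by
    have hk := Subgroupoid.mul _ hp.2 hq.2
    -- A sum is rewritten as a difference, the only operation under control; its value is an
    -- identity because the kernel is closed under sums.
    have hpq : p ≫ q = p ≫ Groupoid.inv (Groupoid.inv q) := by simp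
    refine ⟨?_, hk⟩
    rw [hpq] at hk ⊢
    exact Λ.comp_inv_mem_JrW hp.1 (Λ.inv_mem_JrW hq.1) (Λ.memWG_of_mem_ker hk)

/-- Two differences suffice: $p*k^{-1}$ has the same value as $p$, and subtracting it from $p$ gives
the conjugate, which lies in the normal subgroupoid $\operatorname{Ker}\psi$. -/
theorem conj_mem_J₀_of_mem_JrW {b a : GermObj 𝒞 Λ.L} {p : b ⟶ a} (hp : p ∈ Λ.JrW b a)
    {k : a ⟶ a} (hk : k ∈ Λ.J₀ a a) : p ≫ k ≫ Groupoid.inv p ∈ Λ.J₀ b b := by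
  have hker : p ≫ k ≫ Groupoid.inv p ∈ (Subgroupoid.ker (finalMap 𝒞 Λ.L)).arrows b b :=
    (Subgroupoid.ker_isNormal _).conj' p hk.2
  have hpk : p ≫ Groupoid.inv k ∈ Λ.JrW b a := by
    refine Λ.comp_inv_mem_JrW hp hk.1 ?_
    have h : (finalMap 𝒞 Λ.L).map (p ≫ Groupoid.inv k) = (finalMap 𝒞 Λ.L).map p := by
      rw [finalMap_map_comp_inv, Λ.map_eq_id_of_mem_J₀ hk]
      simp
    rw [h]
    exact Λ.memWG_of_mem_JrW hp
  have he : p ≫ k ≫ Groupoid.inv p = p ≫ Groupoid.inv (p ≫ Groupoid.inv k) := by simp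
  refine ⟨?_, hker⟩
  rw [he] at hker ⊢
  exact Λ.comp_inv_mem_JrW hp hpk (Λ.memWG_of_mem_ker hker)

/-- The germs which normalize `J₀`. -/
def J₀Normalizer : Subgroupoid (GermObj 𝒞 Λ.L) where
  -- Conjugation in both directions is required, so that the set is closed under inverses.
  arrows b a := {p | (∀ k ∈ Λ.J₀ a a, p ≫ k ≫ Groupoid.inv p ∈ Λ.J₀ b b) ∧
    ∀ k ∈ Λ.J₀ b b, Groupoid.inv p ≫ k ≫ p ∈ Λ.J₀ a a}
  inv {_ _ p} hp := ⟨fun k hk => by simpa using hp.2 k hk, fun k hk => by simpa using hp.1 k hk⟩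
  mul {_ _ _ p} hp q hq := ⟨fun k hk => by simpa using hp.1 _ (hq.1 k hk),
    fun k hk => by simpa using hq.2 _ (hp.2 k hk)⟩

theorem Jr_le_J₀Normalizer : Λ.Jr ≤ Λ.J₀Normalizer := by
  refine Λ.Jr_le _ fun b a p hp => ⟨fun k hk => Λ.conj_mem_J₀_of_mem_JrW hp hk, fun k hk => ?_⟩
  simpa using Λ.conj_mem_J₀_of_mem_JrW (Λ.inv_mem_JrW hp) hk

theorem J₀Subgroupoid_le_Jr : Λ.J₀Subgroupoid ≤ Λ.Jr := by
  rw [Subgroupoid.le_iff]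
  exact fun {b a} _ hp => Λ.JrW_subset_Jr b a hp.1

theorem J₀Subgroupoid_isWide : Λ.J₀Subgroupoid.IsWide :=
  ⟨fun a => ⟨Λ.id_mem_JrW a, (Subgroupoid.ker_isNormal _).wide a⟩⟩

/-- Pulling back along the inclusion expresses normality relative to $J^r(\mathcal D(\mathcal C))$,
not in all of $J(\mathcal D(\mathcal C))$. -/
theorem J₀Subgroupoid_comap_isNormal : (Λ.J₀Subgroupoid.comap Λ.Jr.hom).IsNormal where
  wide a := Λ.J₀Subgroupoid_isWide.wide a.1
  conj p _ hk := ((Subgroupoid.le_iff _ _).1 Λ.Jr_le_J₀Normalizer p.2).2 _ hk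

/-- Since $\psi$ is the identity on objects, an arrow of its kernel is a loop. -/
theorem J₀Subgroupoid_isTotallyDisconnected : Λ.J₀Subgroupoid.IsTotallyDisconnected := by
  rw [Subgroupoid.isTotallyDisconnected_iff]
  rintro b a ⟨p, -, hp⟩
  obtain ⟨h, -⟩ := (Subgroupoid.mem_ker_iff _ p).1 hp
  exact h

end VLocallyLie

/-! ### Cosets of a normal subgroupoid and the holonomy quotient. -/

/-- For a wide subgroupoid `N` of `S` which is normal in `S`, belonging to the same coset of `N`
is a congruence on `S`. -/
theorem CategoryTheory.Subgroupoid.congruence_of_comap_isNormal {D : Type*} [Groupoid D] (S N : Subgroupoid D)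
    (hN : (N.comap S.hom).IsNormal) :
    Congruence (fun b _ p q => (p ≫ inv q).val ∈ N.arrows b.val b.val : HomRel S.objs) where
  equivalence :=
    { refl := fun p => by
        have h := hN.wide
        rw [IsIso.hom_inv_id]
        exact h _
      symm := fun {p q} h => by
        have h' := N.inv h
        have e : (q ≫ inv p).val = Groupoid.inv (p ≫ inv q).val := by
          simp
        rw [e]
        exact h'
      trans := fun {p q k} h h' => by
        have e : p ≫ inv k = (p ≫ inv q) ≫ q ≫ inv k := by simp
        rw [e]
        exact N.mul h h' }
  -- Composing with $f$ on the left conjugates the difference, so this is where normality is used;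
  -- composing on the right cancels.
  comp_left f p q h := by
    have h' := hN.conj' (γ := p ≫ inv q) f h
    have e : (f ≫ p) ≫ inv (f ≫ q) = f ≫ (p ≫ inv q) ≫ Groupoid.inv f := by simp
    rw [e]
    exact h'
  comp_right {_ _ _ p q} g h := by
    have e : (p ≫ g) ≫ inv (q ≫ g) = p ≫ inv q := by simp
    rw [e]
    exact h

end

/-- For a `V`-locally Lie double groupoid `(D(C), W^G)`, the set `J₀ = J^r(W^G) ∩ Ker ψ` is a wide
subgroupoid of `J^r(D(C))`. It is normal and consists of loops, and so the quotient groupoid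
`Hol(D(C), W^G) = J^r(D(C)) / J₀` is defined: its arrows are exactly the cosets of `J₀`. -/
theorem mainTheorem6 {X : Type u} [Groupoid.{v} X] {C : X → Type w} [∀ x, AddGroup (C x)]
    (r : Smoothness) (𝒞 : CrossedModule X C) (Λ : VLocallyLie r 𝒞) :
    (∃ N : Subgroupoid (GermObj 𝒞 Λ.L),
      (∀ b a : GermObj 𝒞 Λ.L, N.arrows b a = Λ.J₀ b a) ∧
      N ≤ Λ.Jr ∧
      N.IsWide ∧
      (N.comap Λ.Jr.hom).IsNormal ∧
      N.IsTotallyDisconnected) ∧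
    Congruence Λ.holRel ∧
    ∀ (b a : Λ.Jr.objs) (p q : b ⟶ a), Λ.toHol.map p = Λ.toHol.map q ↔ Λ.holRel p q := by
  have hc : Congruence Λ.holRel :=
    Subgroupoid.congruence_of_comap_isNormal Λ.Jr Λ.J₀Subgroupoid Λ.J₀Subgroupoid_comap_isNormal
  exact ⟨⟨Λ.J₀Subgroupoid, fun _ _ => rfl, Λ.J₀Subgroupoid_le_Jr, Λ.J₀Subgroupoid_isWide,
    Λ.J₀Subgroupoid_comap_isNormal, Λ.J₀Subgroupoid_isTotallyDisconnected⟩, hc,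
    -- The quotient category is formed for an arbitrary relation; `hc`, used as an instance, ensures
    -- that no further arrows are identified.
    fun _ _ p q => CategoryTheory.Quotient.functor_map_eq_iff Λ.holRel p q⟩
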